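/- For a probability measure $\mu$ on $\mathbb{R}$ let $G_\mu(z)=\int \frac{\mu(dx)}{z-x}$, $F_\mu(z)=1/G_\mu(z)$ and $\eta_\mu(z)=1-zF_\mu(1/z)$. All powers of complex numbers are principal values. If $\mu$ is a probability measure on $[0,\infty)$ and $0<t\le 1$, let $\mu^{\langle t\rangle}$ (the multiplicative Boolean convolution power) be the probability measure on $[0,\infty)$ determined by $$\frac{\eta_{\mu^{\langle t\rangle}}(z)}{z}=\Big(\frac{\eta_\mu(z)}{z}\Big)^t,\qquad z\in(-\infty,0),$$ and for $p>0$ and a probability measure $\nu$ on $[0,\infty)$ let $\nu^p$ be the push-forward of $\nu$ by $x\mapsto x^p$. For $\alpha\in(0,1)$, $\rho\in[0,1]$, $r>0$, let $\mathbf{b}_{\alpha,\rho,r}$ (the Boolean stable law) be the probability measure on $\mathbb{R}$ with $F_{\mathbf{b}_{\alpha,\rho,r}}(z)=z+re^{i\alpha\rho\pi}z^{1-\alpha}$ for $\operatorname{Im} z>0$, and let $B_{\alpha,\rho,r}$ be a random variable with this law. **Theorem.** Let $\mu$ be a probability measure on $[0,\infty)$ such that there is an open interval $I\subset(0,\infty)$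 with $1\in I$ for which the limit $F_\mu(x):=\lim_{y\downarrow0}F_\mu(x+iy)\in\mathbb{C}^+\cup\mathbb{R}$ exists for every $x\in I$, and such that the map $x\mapsto F_\mu(x)$ is continuous at $1$. Suppose that for some $\alpha\in(0,1)$, $\rho\in[0,1]$ and $r>0$, $$F_\mu(x)=r e^{i\alpha\rho\pi}(x-1+i0)^{1-\alpha}+o(|x-1|^{1-\alpha})\qquad\text{as } x\to1,\ x\in\mathbb{R}.$$ Then the measures $\mu^{\langle t\rangle}$, $0<t\le1$, and $\mathbf{b}_{\alpha,\rho,r}$ exist, and, writing $\mu_t:=(\mu^{\langle t\rangle})^{t^{-1/\alpha}}$, the following hold. 1. For every compact set $K\subset(1,\infty)$, the measure $\mu_t$ is Lebesgue absolutely continuous on $K$ for all sufficiently small $t>0$, and $$\frac{d\mu_t}{dx}\to\frac{r\sin(\alpha\rho\pi)}{\pi x}\cdot\frac{(\log x)^{\alpha-1}}{(\log x)^{2\alpha}+2r\cos(\alpha\rho\pi)(\log x)^\alpha+r^2}\qquad\text{as } t\downarrow0,$$ uniformly on $K$. 2. For every compact set $K\subset(0,1)$, the measure $\mu_t$ is Lebesgue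 absolutely continuous on $K$ for all sufficiently small $t>0$, and $$\frac{d\mu_t}{dx}\to\frac{r\sin(\alpha(1-\rho)\pi)}{\pi x}\cdot\frac{(-\log x)^{\alpha-1}}{(-\log x)^{2\alpha}+2r\cos(\alpha(1-\rho)\pi)(-\log x)^\alpha+r^2}\qquad\text{as } t\downarrow0,$$ uniformly on $K$. 3. $\mu_t$ converges weakly, as $t\downarrow0$, to the law of $e^{B_{\alpha,\rho,r}}$. In 1 and 2 the convergence is that of suitable (nonnegative, measurable) versions of the densities. -/

import Mathlib

open MeasureTheory Filter Topology Set Asymptotics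

noncomputable section

namespace LogBoolean

/-- The Cauchy transform `G_μ(z) = ∫ μ(dx) / (z - x)`. -/
def cauchyTransform (μ : Measure ℝ) (z : ℂ) : ℂ := ∫ x : ℝ, (z - (x : ℂ))⁻¹ ∂μ

/-- The reciprocal Cauchy transform `F_μ(z) = 1 / G_μ(z)`. -/
def fTransform (μ : Measure ℝ) (z : ℂ) : ℂ := (cauchyTransform μ z)⁻¹

/-- The `η`-transform `η_μ(z) = 1 - z F_μ(1/z)`. -/
def etaTransform (μ : Measure ℝ) (z : ℂ) : ℂ := 1 - z * fTransform μ z⁻¹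

/-- `ν` is a probability measure on `[0, ∞)` with `η_ν(z) / z = (η_μ(z) / z) ^ t` for `z < 0`.
For `μ` on `[0, ∞)` and `z < 0` the number `η_μ(z) / z` is a non-negative real, so that the complex
power is the usual power of a non-negative real. -/
def IsMultBooleanPower (μ : Measure ℝ) (t : ℝ) (ν : Measure ℝ) : Prop :=
  IsProbabilityMeasure ν ∧ ν (Iio 0) = 0 ∧
    ∀ z : ℝ, z < 0 →
      etaTransform ν (z : ℂ) / (z : ℂ) = (etaTransform μ (z : ℂ) / (z : ℂ)) ^ (t : ℂ)

open Classical in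
/-- The multiplicative Boolean convolution power of `μ` with exponent `t`, that is, the measure
determined by `IsMultBooleanPower μ t` (the zero measure if there is none). -/
def multBooleanPower (μ : Measure ℝ) (t : ℝ) : Measure ℝ :=
  if h : ∃ ν, IsMultBooleanPower μ t ν then h.choose else 0

/-- The power `μ ^ p` of a measure on `[0, ∞)`: the push-forward by `x ↦ x ^ p`. -/
def powerLaw (μ : Measure ℝ) (p : ℝ) : Measure ℝ := μ.map (fun x : ℝ => x ^ p)

/-- The boundary value `F_μ(x + i0) = lim_{y ↓ 0} F_μ(x + iy)`. -/
def fBoundary (μ : Measure ℝ) (x : ℝ) : ℂ :=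
  limUnder (𝓝[>] (0 : ℝ)) (fun y : ℝ => fTransform μ ((x : ℂ) + (y : ℂ) * Complex.I))

/-- There is an open interval `I ⊆ (0, ∞)` containing `1` such that the limit `F_μ(x + i0)` exists
in the closed upper half-plane for every `x ∈ I`, and `x ↦ F_μ(x + i0)` is continuous at `1`. -/
def BoundaryValueAssumption (μ : Measure ℝ) : Prop :=
  (∃ I : Set ℝ, IsOpen I ∧ I.OrdConnected ∧ I ⊆ Ioi 0 ∧ (1 : ℝ) ∈ I ∧
    ∀ x ∈ I, ∃ w : ℂ, 0 ≤ w.im ∧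
      Tendsto (fun y : ℝ => fTransform μ ((x : ℂ) + (y : ℂ) * Complex.I)) (𝓝[>] 0) (𝓝 w)) ∧
  ContinuousAt (fBoundary μ) 1

/-- `β` is a probability measure on `ℝ` with `F_β(z) = z + r e^{iαρπ} z^{1-α}` on the upper
half-plane (principal branch). -/
def IsBooleanStableLaw (α ρ r : ℝ) (β : Measure ℝ) : Prop :=
  IsProbabilityMeasure β ∧ ∀ z : ℂ, 0 < z.im →
    fTransform β z =
      z + (r : ℂ) * Complex.exp (Complex.I * (α * ρ * Real.pi : ℝ)) * z ^ ((1 - α : ℝ) : ℂ)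

open Classical in
/-- The Boolean stable law `b_{α,ρ,r}`, that is, the measure determined by
`IsBooleanStableLaw α ρ r` (the zero measure if there is none). -/
def booleanStableLaw (α ρ r : ℝ) : Measure ℝ :=
  if h : ∃ β, IsBooleanStableLaw α ρ r β then h.choose else 0

/-- The log Boolean stable law, that is, the law of `e^B` for `B` distributed as `b_{α,ρ,r}`. -/
def logBooleanStableLaw (α ρ r : ℝ) : Measure ℝ := (booleanStableLaw α ρ r).map Real.exp

/-- On each compact `K ⊆ U`, the measure `ν t` is Lebesgue absolutely continuous for small `t > 0`,
and its density converges to `p` uniformly on `K` as `t ↓ 0`. The function `f t` is a version of the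
density of `ν t` on `U`, which by itself is determined only up to a Lebesgue null set. -/
def DensitiesTendstoUniformlyOnCompacts (ν : ℝ → Measure ℝ) (p : ℝ → ℝ) (U : Set ℝ) : Prop :=
  ∃ f : ℝ → ℝ → ℝ, (∀ t, Measurable (f t)) ∧ (∀ t x, 0 ≤ f t x) ∧
    ∀ K : Set ℝ, IsCompact K → K ⊆ U →
      (∀ᶠ t in 𝓝[>] (0 : ℝ), (ν t).restrict K =
        (volume.restrict K).withDensity (fun x => ENNReal.ofReal (f t x))) ∧
      TendstoUniformlyOn f p (𝓝[>] (0 : ℝ)) K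

end LogBoolean

end

/-!
For a probability measure `μ` on `[0, ∞)` put `K_μ(z) = z - F_μ(z)`. As `η_μ(z) / z = K_μ(1 / z)`,
the multiplicative Boolean power is the plain power: `K_{μ^⟨t⟩} = K_μ ^ t`
(`isMultBooleanPower_iff`).

*Existence.* `K_μ` maps the upper half-plane into the closed lower half-plane, and because
`F_μ(1 + i0) = 0` it avoids `(-∞, 0]` (`selfEnergy_mem_slitPlane`); hence `1 / (z - K_μ(z) ^ t)`
maps the upper half-plane to the lower one and behaves like `1 / z` at infinity. Such a function is
a Cauchy transform (`exists_cauchyTransform_eq`): on the disc, Poisson's formula on circles of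
radius `R < 1` and compactness of the measures of given mass on the circle give Herglotz' theorem,
which the Cayley transform carries over to the half-plane. The Boolean stable law comes from the
same criterion.

*Densities.* If the Cauchy transform of a measure has finite vertical limits `g` at every point of a
set, the measure is absolutely continuous there with density `-Im g / π`
(`restrict_eq_withDensity_of_tendsto_cauchyTransform`). No uniformity is needed: by the layer cake
formula a Poisson integral is an average of the ratios `ν (B(x, s)) / |B(x, s)|`, so that the
theorem on differentiation of measures applies. Thus `μ^⟨t⟩` has near `1` the density
`-Im (1 / Φ_t) / π` with `Φ_t(x) = x - (x - F_μ(x + i0)) ^ t`.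

*Scaling.* Put `q = t^{1/α}` and `x = e^{qu}`. Then `F_μ(x) / q^{1-α}` converges to
`r e^{iαρπ} u^{1-α}`, so that `t log K_μ(x) / q` converges to minus that limit, and
`Φ_t(e^{qu}) / q` converges to `u + r e^{iαρπ} u^{1-α}`, which is the reciprocal Cauchy transform of
the Boolean stable law (`tendsto_powerBoundary_div`). The convergence is joint in `(t, u)`, hence
uniform on compact sets, and changing variables by `y = e^u` gives the limit densities.

*Weak convergence.* The limit densities are those of `e^B`, and `e^B` has no mass at `1` because `B`
has no atom at `0`. As the limit is a probability measure, convergence of the densities on compact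
sets avoiding `1` implies weak convergence (`tendsto_integral_of_densities`).
-/

namespace LogBoolean

/-! ### The Cauchy transform -/

theorem cauchyTransform_eq_neg_resolventTransform (μ : Measure ℝ) (z : ℂ) :
    cauchyTransform μ z = -resolventTransform μ z := by
  rw [cauchyTransform, resolventTransform_apply, ← integral_neg]
  refine integral_congr_ae (Eventually.of_forall fun x => ?_)
  simp only [resolvent, Ring.inverse_eq_inv', Complex.coe_algebraMap]
  rw [← inv_neg, neg_sub]

theorem differentiableAt_cauchyTransform {μ : Measure ℝ} [IsFiniteMeasure μ] {z : ℂ}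
    (hz : z ∉ (fun x : ℝ => (x : ℂ)) '' μ.support) :
    DifferentiableAt ℂ (cauchyTransform μ) z := by
  have h := (hasDerivAt_resolventTransform (𝕜 := ℝ) (μ := μ) z hz).differentiableAt.neg
  refine h.congr_of_eventuallyEq (Eventually.of_forall fun w => ?_)
  simp [cauchyTransform_eq_neg_resolventTransform]

theorem notMem_image_support_of_im_ne_zero (μ : Measure ℝ) {z : ℂ} (hz : z.im ≠ 0) :
    z ∉ (fun x : ℝ => (x : ℂ)) '' μ.support := by
  rintro ⟨x, -, rfl⟩
  simp at hz

/-- A measure on `[0, ∞)` has its support in `[0, ∞)`. -/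
theorem support_subset_Ici {μ : Measure ℝ} (hμ : μ (Iio 0) = 0) : μ.support ⊆ Ici 0 := by
  intro x hx
  by_contra h
  simp only [mem_Ici, not_le] at h
  refine (Measure.notMem_support_iff.2 ?_) hx
  exact (eventually_smallSets_subset.2 (Iio_mem_nhds h)).mono
    fun s hs => measure_mono_null hs hμ

theorem notMem_image_support_of_neg_mem_slitPlane {μ : Measure ℝ} (hμ : μ (Iio 0) = 0) {z : ℂ}
    (hz : -z ∈ Complex.slitPlane) : z ∉ (fun x : ℝ => (x : ℂ)) '' μ.support := by
  rintro ⟨x, hx, rfl⟩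
  have h0 : 0 ≤ x := support_subset_Ici hμ hx
  rcases Complex.mem_slitPlane_iff.1 hz with h | h <;> simp at h
  linarith

theorem differentiableOn_cauchyTransform_upper (μ : Measure ℝ) [IsFiniteMeasure μ] :
    DifferentiableOn ℂ (cauchyTransform μ) {z | 0 < z.im} := fun _ hz =>
  (differentiableAt_cauchyTransform (notMem_image_support_of_im_ne_zero μ
    (ne_of_gt hz))).differentiableWithinAt

theorem isOpen_upper : IsOpen {z : ℂ | 0 < z.im} := isOpen_lt continuous_const Complex.continuous_im

theorem isPreconnected_upper : IsPreconnected {z : ℂ | 0 < z.im} :=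
  (convex_halfSpace_im_gt 0).isPreconnected

theorem sub_ofReal_ne_zero {z : ℂ} (hz : 0 < z.im) (x : ℝ) : z - x ≠ 0 := fun h => by
  have := congrArg Complex.im h
  simp at this
  linarith

theorem norm_inv_sub_ofReal_le {z : ℂ} (hz : 0 < z.im) (x : ℝ) : ‖(z - (x : ℂ))⁻¹‖ ≤ z.im⁻¹ := by
  rw [norm_inv]
  refine inv_anti₀ hz ?_
  calc z.im = |(z - x).im| := by simp [abs_of_pos hz]
    _ ≤ _ := Complex.abs_im_le_norm _

theorem continuous_inv_sub_ofReal {z : ℂ} (hz : 0 < z.im) :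
    Continuous fun x : ℝ => (z - (x : ℂ))⁻¹ :=
  (continuous_const.sub Complex.continuous_ofReal).inv₀ (sub_ofReal_ne_zero hz)

theorem integrable_inv_sub_ofReal (μ : Measure ℝ) [IsFiniteMeasure μ] {z : ℂ} (hz : 0 < z.im) :
    Integrable (fun x : ℝ => (z - (x : ℂ))⁻¹) μ :=
  Integrable.of_bound (continuous_inv_sub_ofReal hz).aestronglyMeasurable _
    (Eventually.of_forall (norm_inv_sub_ofReal_le hz))

/-- The Poisson kernel of the upper half-plane, up to the factor `1 / π`. -/
noncomputable def halfPlanePoisson (z : ℂ) (x : ℝ) : ℝ := z.im / Complex.normSq (z - x)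

theorem inv_sub_ofReal_im (z : ℂ) (x : ℝ) : ((z - (x : ℂ))⁻¹).im = -halfPlanePoisson z x := by
  simp [Complex.inv_im, halfPlanePoisson, neg_div]

theorem halfPlanePoisson_nonneg {z : ℂ} (hz : 0 ≤ z.im) (x : ℝ) : 0 ≤ halfPlanePoisson z x :=
  div_nonneg hz (Complex.normSq_nonneg _)

theorem halfPlanePoisson_pos {z : ℂ} (hz : 0 < z.im) (x : ℝ) : 0 < halfPlanePoisson z x :=
  div_pos hz (Complex.normSq_pos.2 (sub_ofReal_ne_zero hz x))

theorem integrable_halfPlanePoisson (μ : Measure ℝ) [IsFiniteMeasure μ] {z : ℂ} (hz : 0 < z.im) :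
    Integrable (halfPlanePoisson z) μ := by
  have h := (integrable_inv_sub_ofReal μ hz).im.neg
  refine h.congr (Eventually.of_forall fun x => ?_)
  simpa using congrArg Neg.neg (inv_sub_ofReal_im z x)

theorem cauchyTransform_im (μ : Measure ℝ) [IsFiniteMeasure μ] {z : ℂ} (hz : 0 < z.im) :
    (cauchyTransform μ z).im = -∫ x, halfPlanePoisson z x ∂μ := by
  rw [cauchyTransform, ← integral_neg]
  refine (integral_im (𝕜 := ℂ) (integrable_inv_sub_ofReal μ hz)).symm.trans ?_
  exact integral_congr_ae (Eventually.of_forall fun x => inv_sub_ofReal_im z x)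

theorem ofReal_neg_cauchyTransform_im (μ : Measure ℝ) [IsFiniteMeasure μ] {z : ℂ} (hz : 0 < z.im) :
    ENNReal.ofReal (-(cauchyTransform μ z).im) =
      ∫⁻ x, ENNReal.ofReal (halfPlanePoisson z x) ∂μ := by
  rw [cauchyTransform_im μ hz, neg_neg, ofReal_integral_eq_lintegral_ofReal
    (integrable_halfPlanePoisson μ hz)
    (Eventually.of_forall fun x => halfPlanePoisson_nonneg hz.le x)]

theorem cauchyTransform_im_neg (μ : Measure ℝ) [IsProbabilityMeasure μ] {z : ℂ} (hz : 0 < z.im) :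
    (cauchyTransform μ z).im < 0 := by
  rw [cauchyTransform_im μ hz, neg_lt_zero,
    integral_pos_iff_support_of_nonneg (halfPlanePoisson_nonneg hz.le)
      (integrable_halfPlanePoisson μ hz)]
  have : Function.support (halfPlanePoisson z) = univ := by
    ext x
    simp [(halfPlanePoisson_pos hz x).ne']
  simp [this]

theorem cauchyTransform_ne_zero (μ : Measure ℝ) [IsProbabilityMeasure μ] {z : ℂ} (hz : 0 < z.im) :
    cauchyTransform μ z ≠ 0 := fun h => by
  have := cauchyTransform_im_neg μ hz
  simp [h] at this

/-- Jensen's inequality `|G_μ(z)|² ≤ ∫ |z - x|⁻² μ(dx)`, multiplied by `Im z`. -/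
theorem im_mul_normSq_cauchyTransform_le (μ : Measure ℝ) [IsProbabilityMeasure μ] {z : ℂ}
    (hz : 0 < z.im) :
    z.im * Complex.normSq (cauchyTransform μ z) ≤ -(cauchyTransform μ z).im := by
  have hint := integrable_halfPlanePoisson μ hz
  have hsq : (fun x : ℝ => ‖(z - (x : ℂ))⁻¹‖ ^ 2) = fun x => z.im⁻¹ * halfPlanePoisson z x := by
    funext x
    rw [norm_inv, inv_pow, ← Complex.normSq_eq_norm_sq, halfPlanePoisson]
    field_simp
  have hJ := (convexOn_pow 2).map_integral_le (μ := μ) (s := Ici (0 : ℝ))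
    (f := fun x : ℝ => ‖(z - (x : ℂ))⁻¹‖) (by fun_prop) isClosed_Ici
    (Eventually.of_forall fun x => norm_nonneg _) (integrable_inv_sub_ofReal μ hz).norm
    (by simpa only [Function.comp_def, hsq] using hint.const_mul _)
  rw [hsq, integral_const_mul] at hJ
  have h1 : Complex.normSq (cauchyTransform μ z) ≤ z.im⁻¹ * ∫ x, halfPlanePoisson z x ∂μ := by
    rw [Complex.normSq_eq_norm_sq]
    refine le_trans ?_ hJ
    gcongr
    exact norm_integral_le_integral_norm _
  rw [cauchyTransform_im μ hz, neg_neg]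
  calc _ ≤ z.im * (z.im⁻¹ * ∫ x, halfPlanePoisson z x ∂μ) := by gcongr
    _ = _ := by field_simp

theorem im_le_fTransform_im (μ : Measure ℝ) [IsProbabilityMeasure μ] {z : ℂ} (hz : 0 < z.im) :
    z.im ≤ (fTransform μ z).im := by
  rw [fTransform, Complex.inv_im,
    le_div_iff₀ (Complex.normSq_pos.2 (cauchyTransform_ne_zero μ hz))]
  exact im_mul_normSq_cauchyTransform_le μ hz

theorem differentiableOn_fTransform_upper (μ : Measure ℝ) [IsProbabilityMeasure μ] :
    DifferentiableOn ℂ (fTransform μ) {z | 0 < z.im} :=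
  (differentiableOn_cauchyTransform_upper μ).inv fun _ hz => cauchyTransform_ne_zero μ hz

theorem tendsto_mul_cauchyTransform_atTop (μ : Measure ℝ) [IsProbabilityMeasure μ] :
    Tendsto (fun y : ℝ => (y * Complex.I) * cauchyTransform μ (y * Complex.I)) atTop (𝓝 1) := by
  have hlim : Tendsto (fun y : ℝ => ∫ x : ℝ, (y * Complex.I) * ((y * Complex.I) - (x : ℂ))⁻¹ ∂μ)
      atTop (𝓝 (∫ _ : ℝ, (1 : ℂ) ∂μ)) := by
    refine tendsto_integral_filter_of_dominated_convergence (fun _ => 1) ?_ ?_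
      (integrable_const _) ?_
    · filter_upwards [eventually_gt_atTop 0] with y hy
      exact (continuous_const.mul
        (continuous_inv_sub_ofReal (by simpa using hy))).aestronglyMeasurable
    · filter_upwards [eventually_gt_atTop 0] with y hy
      refine Eventually.of_forall fun x => ?_
      have := norm_inv_sub_ofReal_le (z := y * Complex.I) (by simpa using hy) x
      rw [norm_mul]
      calc _ ≤ ‖(y : ℂ) * Complex.I‖ * (y)⁻¹ := by gcongr; simpa using this
        _ = 1 := by simp [abs_of_pos hy, hy.ne']
    · refine Eventually.of_forall fun x => ?_
      have h0 : Tendsto (fun y : ℝ => (1 - (x : ℂ) / (y * Complex.I))⁻¹) atTop (𝓝 (1 - 0)⁻¹) := by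
        refine (tendsto_const_nhds.sub ?_).inv₀ (by simp)
        rw [tendsto_zero_iff_norm_tendsto_zero]
        simp only [norm_div, norm_mul, Complex.norm_real, Complex.norm_I, mul_one]
        exact tendsto_const_nhds.div_atTop (tendsto_abs_atTop_atTop)
      simp only [sub_zero, inv_one] at h0
      refine h0.congr' ?_
      filter_upwards [eventually_gt_atTop 0] with y hy
      have h1 : (y : ℂ) * Complex.I ≠ 0 := by simp [hy.ne']
      have h2 := sub_ofReal_ne_zero (z := y * Complex.I) (by simpa using hy) x
      rw [one_sub_div h1, inv_div, div_eq_mul_inv]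
  simpa [cauchyTransform, integral_const_mul] using hlim

theorem tendsto_fTransform_div_atTop (μ : Measure ℝ) [IsProbabilityMeasure μ] :
    Tendsto (fun y : ℝ => fTransform μ (y * Complex.I) / (y * Complex.I)) atTop (𝓝 1) := by
  have := (tendsto_mul_cauchyTransform_atTop μ).inv₀ one_ne_zero
  simpa [fTransform, mul_comm, div_eq_mul_inv] using this

/-! ### Stieltjes inversion from pointwise boundary values -/

theorem halfPlanePoisson_add_mul_I (x y u : ℝ) :
    halfPlanePoisson (x + y * Complex.I) u = y / ((x - u) ^ 2 + y ^ 2) := by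
  simp [halfPlanePoisson, Complex.normSq_apply, sq]

theorem continuous_halfPlanePoisson {z : ℂ} (hz : 0 < z.im) : Continuous (halfPlanePoisson z) := by
  have : halfPlanePoisson z = fun x : ℝ => -((z - (x : ℂ))⁻¹).im := by
    funext x; rw [inv_sub_ofReal_im, neg_neg]
  rw [this]
  exact (Complex.continuous_im.comp (continuous_inv_sub_ofReal hz)).neg

/-- The super-level sets of the Poisson kernel are balls. -/
theorem setOf_le_mul_halfPlanePoisson {x y σ : ℝ} (hy : 0 < y) (hσ : σ ∈ Ioo (0 : ℝ) 1) :
    {u | σ ≤ y * halfPlanePoisson (x + y * Complex.I) u} =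
      Metric.closedBall x (y * √(σ⁻¹ - 1)) := by
  have h1 : 0 ≤ σ⁻¹ - 1 := sub_nonneg.2 ((one_le_inv₀ hσ.1).2 hσ.2.le)
  ext u
  have hpos : 0 < (x - u) ^ 2 + y ^ 2 := by positivity
  rw [mem_ofPred_eq, halfPlanePoisson_add_mul_I, Metric.mem_closedBall, Real.dist_eq,
    ← mul_div_assoc, le_div_iff₀ hpos, ← sq_le_sq₀ (abs_nonneg (u - x)) (by positivity), sq_abs,
    mul_pow, Real.sq_sqrt h1, ← mul_le_mul_iff_right₀ (b := (u - x) ^ 2) hσ.1]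
  have hσ0 := hσ.1
  have : σ * (y ^ 2 * (σ⁻¹ - 1)) = y ^ 2 - σ * y ^ 2 := by field_simp
  rw [this]
  constructor <;> intro h <;> nlinarith

theorem setOf_le_mul_halfPlanePoisson_eq_empty {x y σ : ℝ} (hy : 0 < y) (hσ : 1 < σ) :
    {u | σ ≤ y * halfPlanePoisson (x + y * Complex.I) u} = ∅ := by
  ext u
  have hpos : 0 < (x - u) ^ 2 + y ^ 2 := by positivity
  simp only [mem_ofPred_eq, mem_empty_iff_false, iff_false, not_le]
  rw [halfPlanePoisson_add_mul_I, ← mul_div_assoc, div_lt_iff₀ hpos]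
  nlinarith [sq_nonneg (x - u), mul_pos hy hy]

/-- By the layer cake formula, a Poisson integral is an average of the mean densities of `ν` on
balls around the base point. -/
theorem lintegral_halfPlanePoisson_eq (ν : Measure ℝ) (x : ℝ) {y : ℝ} (hy : 0 < y) :
    ∫⁻ u, ENNReal.ofReal (halfPlanePoisson (x + y * Complex.I) u) ∂ν =
      ∫⁻ σ in Ioo (0 : ℝ) 1, ν (Metric.closedBall x (y * √(σ⁻¹ - 1))) /
        volume (Metric.closedBall x (y * √(σ⁻¹ - 1))) * ENNReal.ofReal (2 * √(σ⁻¹ - 1)) := by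
  have hz : 0 < (x + y * Complex.I : ℂ).im := by simpa using hy
  have hy0 : ENNReal.ofReal y ≠ 0 := by simpa using hy
  rw [← ENNReal.mul_right_inj hy0 ENNReal.ofReal_ne_top,
    ← lintegral_const_mul' _ _ ENNReal.ofReal_ne_top,
    ← lintegral_const_mul' _ _ ENNReal.ofReal_ne_top]
  simp_rw [← ENNReal.ofReal_mul hy.le]
  rw [lintegral_eq_lintegral_meas_le ν
    (Eventually.of_forall fun u => mul_nonneg hy.le (halfPlanePoisson_nonneg hz.le u))
    ((continuous_halfPlanePoisson hz).measurable.const_mul y).aemeasurable]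
  have hsplit : Ioi (0 : ℝ) = Ioc 0 1 ∪ Ioi 1 := (Ioc_union_Ioi_eq_Ioi zero_le_one).symm
  rw [hsplit, lintegral_union measurableSet_Ioi (by
    rw [Set.disjoint_left]; intro a ha hb; exact absurd ha.2 (not_le.2 hb)),
    setLIntegral_congr_fun (g := fun _ => 0) measurableSet_Ioi (fun σ hσ => by
      simp only [setOf_le_mul_halfPlanePoisson_eq_empty hy hσ, measure_empty]),
    lintegral_zero, add_zero, ← setLIntegral_congr Ioo_ae_eq_Ioc]
  refine setLIntegral_congr_fun measurableSet_Ioo fun σ hσ => ?_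
  have hs : 0 < √(σ⁻¹ - 1) := Real.sqrt_pos.2 (sub_pos.2 ((one_lt_inv₀ hσ.1).2 hσ.2))
  simp only [setOf_le_mul_halfPlanePoisson hy hσ, Real.volume_closedBall]
  have e : 2 * (y * √(σ⁻¹ - 1)) = y * (2 * √(σ⁻¹ - 1)) := by ring
  rw [mul_left_comm, ← ENNReal.ofReal_mul hy.le, e, ENNReal.div_mul_cancel]
  · simp only [ne_eq, ENNReal.ofReal_eq_zero, not_le]; positivity
  · exact ENNReal.ofReal_ne_top

theorem lintegral_halfPlanePoisson_volume (x : ℝ) {y : ℝ} (hy : 0 < y) :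
    ∫⁻ u, ENNReal.ofReal (halfPlanePoisson (x + y * Complex.I) u) = ENNReal.ofReal Real.pi := by
  have hint : Integrable (fun u : ℝ => (1 + u ^ 2)⁻¹) := integrable_inv_one_add_sq
  have key : ∀ u, halfPlanePoisson (x + y * Complex.I) u =
      y⁻¹ * (fun u : ℝ => (1 + u ^ 2)⁻¹) (y⁻¹ * (u - x)) := by
    intro u
    simp only [halfPlanePoisson_add_mul_I]
    have : 0 < (x - u) ^ 2 + y ^ 2 := by positivity
    have : 0 < 1 + (y⁻¹ * (u - x)) ^ 2 := by positivity
    field_simp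
    ring
  have hint' : Integrable (fun u : ℝ => y⁻¹ * (fun u : ℝ => (1 + u ^ 2)⁻¹) (y⁻¹ * (u - x))) :=
    ((hint.comp_mul_left' (inv_ne_zero hy.ne')).comp_sub_right x).const_mul _
  simp_rw [key]
  rw [← ofReal_integral_eq_lintegral_ofReal hint'
    (Eventually.of_forall fun u => by positivity), integral_const_mul,
    integral_sub_right_eq_self (fun u => (fun u : ℝ => (1 + u ^ 2)⁻¹) (y⁻¹ * u)) x,
    Measure.integral_comp_mul_left (fun u : ℝ => (1 + u ^ 2)⁻¹) y⁻¹, integral_univ_inv_one_add_sq]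
  simp [abs_of_pos hy, hy.ne']

/-- The value of this integral is read off from the layer cake formula for Lebesgue measure. -/
theorem lintegral_two_mul_sqrt_inv_sub_one :
    ∫⁻ σ in Ioo (0 : ℝ) 1, ENNReal.ofReal (2 * √(σ⁻¹ - 1)) = ENNReal.ofReal Real.pi := by
  rw [← lintegral_halfPlanePoisson_volume 0 one_pos, lintegral_halfPlanePoisson_eq _ _ one_pos]
  refine setLIntegral_congr_fun measurableSet_Ioo fun σ hσ => ?_
  have hs : 0 < √(σ⁻¹ - 1) := Real.sqrt_pos.2 (sub_pos.2 ((one_lt_inv₀ hσ.1).2 hσ.2))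
  simp only [Real.volume_closedBall]
  rw [ENNReal.div_self, one_mul]
  · simp only [ne_eq, ENNReal.ofReal_eq_zero, not_le]; positivity
  · exact ENNReal.ofReal_ne_top

/-- **Fatou's theorem** for Poisson integrals: they converge, up to the factor `π`, to the
symmetric derivative of the measure, where it exists. -/
theorem tendsto_lintegral_halfPlanePoisson (ν : Measure ℝ) [IsFiniteMeasure ν] {x : ℝ}
    {d : ENNReal} (hd : d ≠ ⊤)
    (h : Tendsto (fun r => ν (Metric.closedBall x r) / volume (Metric.closedBall x r))
      (𝓝[>] 0) (𝓝 d)) :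
    Tendsto (fun y : ℝ => ∫⁻ u, ENNReal.ofReal (halfPlanePoisson (x + y * Complex.I) u) ∂ν)
      (𝓝[>] 0) (𝓝 (d * ENNReal.ofReal Real.pi)) := by
  -- the mean densities are bounded: near radius zero by convergence, elsewhere as `ν` is finite
  obtain ⟨C, hC, hbound⟩ : ∃ C : ENNReal, C ≠ ⊤ ∧ ∀ r > 0,
      ν (Metric.closedBall x r) / volume (Metric.closedBall x r) ≤ C := by
    have h1 : ∀ᶠ r in 𝓝[>] (0 : ℝ),
        ν (Metric.closedBall x r) / volume (Metric.closedBall x r) ≤ d + 1 :=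
      (h.eventually_lt_const (ENNReal.lt_add_right hd one_ne_zero)).mono fun _ h => h.le
    obtain ⟨δ, hδ, hδ'⟩ := mem_nhdsGT_iff_exists_Ioo_subset.1 h1
    have hδ0 : (0 : ℝ) < δ := hδ
    refine ⟨max (d + 1) (ν univ / ENNReal.ofReal (2 * δ)), ?_, fun r hr => ?_⟩
    · refine (max_lt ?_ ?_).ne
      · exact ENNReal.add_lt_top.2 ⟨hd.lt_top, ENNReal.one_lt_top⟩
      · exact ENNReal.div_lt_top (measure_ne_top _ _) (by simpa using hδ0)
    · by_cases hrδ : r < δ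
      · exact le_max_of_le_left (hδ' ⟨hr, hrδ⟩)
      · refine le_max_of_le_right ?_
        rw [Real.volume_closedBall]
        gcongr
        · exact subset_univ _
        · exact not_lt.1 hrδ
  rw [← lintegral_two_mul_sqrt_inv_sub_one,
    ← lintegral_const_mul' _ _ hd]
  have hpos : ∀ σ ∈ Ioo (0 : ℝ) 1, 0 < √(σ⁻¹ - 1) := fun σ hσ =>
    Real.sqrt_pos.2 (sub_pos.2 ((one_lt_inv₀ hσ.1).2 hσ.2))
  have hconv : Tendsto (fun y : ℝ => ∫⁻ σ in Ioo (0 : ℝ) 1,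
      ν (Metric.closedBall x (y * √(σ⁻¹ - 1))) /
        volume (Metric.closedBall x (y * √(σ⁻¹ - 1))) * ENNReal.ofReal (2 * √(σ⁻¹ - 1)))
      (𝓝[>] 0) (𝓝 (∫⁻ σ in Ioo (0 : ℝ) 1, d * ENNReal.ofReal (2 * √(σ⁻¹ - 1)))) := by
    refine tendsto_lintegral_filter_of_dominated_convergence
      (fun σ => C * ENNReal.ofReal (2 * √(σ⁻¹ - 1))) ?_ ?_ ?_ ?_
    · filter_upwards [self_mem_nhdsWithin] with y hy
      have hmono : ∀ ρ : Measure ℝ, Measurable fun r => ρ (Metric.closedBall x r) := fun ρ =>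
        Monotone.measurable fun a b hab => measure_mono (Metric.closedBall_subset_closedBall hab)
      have hs : Measurable fun σ : ℝ => y * √(σ⁻¹ - 1) := by fun_prop
      exact (((hmono ν).comp hs).div ((hmono volume).comp hs)).mul (by fun_prop)
    · filter_upwards [self_mem_nhdsWithin] with y hy
      filter_upwards [ae_restrict_mem measurableSet_Ioo] with σ hσ
      gcongr
      exact hbound _ (mul_pos hy (hpos σ hσ))
    · rw [lintegral_const_mul' _ _ hC, lintegral_two_mul_sqrt_inv_sub_one]
      exact ENNReal.mul_ne_top hC ENNReal.ofReal_ne_top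
    · filter_upwards [ae_restrict_mem measurableSet_Ioo] with σ hσ
      refine ENNReal.Tendsto.mul_const (h.comp ?_) (Or.inr ENNReal.ofReal_ne_top)
      refine tendsto_nhdsWithin_iff.2 ⟨?_, ?_⟩
      · have : Tendsto (fun y : ℝ => y * √(σ⁻¹ - 1)) (𝓝 0) (𝓝 (0 * √(σ⁻¹ - 1))) :=
          tendsto_id.mul_const _
        rw [zero_mul] at this
        exact this.mono_left nhdsWithin_le_nhds
      · filter_upwards [self_mem_nhdsWithin] with y hy
        exact mul_pos hy (hpos σ hσ)
  refine hconv.congr' ?_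
  filter_upwards [self_mem_nhdsWithin] with y hy
  exact (lintegral_halfPlanePoisson_eq ν x hy).symm

/-- The mean density on a ball is at most twice the Poisson integral at that height. -/
theorem measure_closedBall_div_le (ν : Measure ℝ) (x : ℝ) {y : ℝ} (hy : 0 < y) :
    ν (Metric.closedBall x y) / volume (Metric.closedBall x y) ≤
      ∫⁻ u, ENNReal.ofReal (halfPlanePoisson (x + y * Complex.I) u) ∂ν := by
  have h1 : ν (Metric.closedBall x y) / volume (Metric.closedBall x y) =
      ∫⁻ _ in Metric.closedBall x y, ENNReal.ofReal (2 * y)⁻¹ ∂ν := by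
    rw [setLIntegral_const, Real.volume_closedBall, ENNReal.ofReal_inv_of_pos (by positivity),
      mul_comm, ENNReal.div_eq_inv_mul]
  rw [h1]
  refine (setLIntegral_mono' Metric.isClosed_closedBall.measurableSet fun u hu => ?_).trans
    (setLIntegral_le_lintegral _ _)
  refine ENNReal.ofReal_le_ofReal ?_
  rw [Metric.mem_closedBall, Real.dist_eq, ← sq_le_sq₀ (abs_nonneg _) hy.le, sq_abs] at hu
  rw [halfPlanePoisson_add_mul_I, inv_eq_one_div,
    div_le_div_iff₀ (by positivity) (by positivity)]
  nlinarith

/-- Where the Poisson integrals stay bounded at small heights, the upper density of the measure is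
finite, so that it has no singular part. -/
theorem absolutelyContinuous_restrict_of_bounded_poisson (ν : Measure ℝ) [IsFiniteMeasure ν]
    {A : Set ℝ} (hA : MeasurableSet A)
    (h : ∀ x ∈ A, ∃ C : ENNReal, C ≠ ⊤ ∧ ∀ᶠ y : ℝ in 𝓝[>] (0 : ℝ),
      ∫⁻ u, ENNReal.ofReal (halfPlanePoisson (x + y * Complex.I) u) ∂ν ≤ C) :
    ν.restrict A ≪ volume := by
  -- the derivative of Lebesgue measure with respect to `ν` is positive almost everywhere on `A`
  have hpos : ∀ᵐ x ∂ν, x ∈ A → (volume : Measure ℝ).rnDeriv ν x ≠ 0 := by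
    filter_upwards [Besicovitch.ae_tendsto_rnDeriv (volume : Measure ℝ) ν] with x hx hxA h0
    obtain ⟨C, hC, hCy⟩ := h x hxA
    have : C⁻¹ ≤ (volume : Measure ℝ).rnDeriv ν x := by
      refine ge_of_tendsto hx ?_
      filter_upwards [hCy, self_mem_nhdsWithin] with y hy hy0
      have hy0' : (0 : ℝ) < y := hy0
      rw [← ENNReal.inv_div (Or.inl (by
        rw [Real.volume_closedBall]; exact ENNReal.ofReal_ne_top))
        (Or.inl (by simpa [Real.volume_closedBall] using hy0'))]
      exact ENNReal.inv_le_inv.2 ((measure_closedBall_div_le ν x hy0).trans hy)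
    rw [h0, nonpos_iff_eq_zero, ENNReal.inv_eq_zero] at this
    exact hC this
  refine Measure.AbsolutelyContinuous.mk fun N hN hN0 => ?_
  rw [Measure.restrict_apply hN]
  have hint : ∫⁻ x in N ∩ A, (volume : Measure ℝ).rnDeriv ν x ∂ν = 0 :=
    le_antisymm ((Measure.setLIntegral_rnDeriv_le _).trans
      ((measure_mono inter_subset_left).trans hN0.le)) bot_le
  rw [setLIntegral_eq_zero_iff (hN.inter hA) (Measure.measurable_rnDeriv _ _)] at hint
  refine measure_eq_zero_iff_ae_notMem.2 ?_
  filter_upwards [hint, hpos] with x h1 h2 hx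
  exact h2 hx.2 (h1 hx)

/-- **Stieltjes inversion.** If the Cauchy transform has finite vertical limits `g` at every point
of `A`, then the measure is absolutely continuous on `A` with density `-Im g / π`. -/
theorem restrict_eq_withDensity_of_tendsto_cauchyTransform (ν : Measure ℝ) [IsFiniteMeasure ν]
    {A : Set ℝ} (hA : MeasurableSet A) {g : ℝ → ℂ}
    (h : ∀ x ∈ A, Tendsto (fun y : ℝ => cauchyTransform ν (x + y * Complex.I)) (𝓝[>] 0)
      (𝓝 (g x))) :
    ν.restrict A = (volume.restrict A).withDensity
      (fun x => ENNReal.ofReal (-(g x).im / Real.pi)) := by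
  have hlim : ∀ x ∈ A, Tendsto
      (fun y : ℝ => ∫⁻ u, ENNReal.ofReal (halfPlanePoisson (x + y * Complex.I) u) ∂ν) (𝓝[>] 0)
      (𝓝 (ENNReal.ofReal (-(g x).im))) := fun x hx => by
    refine (ENNReal.tendsto_ofReal
      ((Complex.continuous_im.tendsto _).comp (h x hx)).neg).congr' ?_
    filter_upwards [self_mem_nhdsWithin] with y hy
    exact ofReal_neg_cauchyTransform_im ν (by simpa using hy)
  have hac : ν.restrict A ≪ volume := by
    refine absolutelyContinuous_restrict_of_bounded_poisson ν hA fun x hx =>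
      ⟨ENNReal.ofReal (-(g x).im) + 1, by simp, ?_⟩
    exact ((hlim x hx).eventually_lt_const
      (ENNReal.lt_add_right ENNReal.ofReal_ne_top one_ne_zero)).mono fun _ h => h.le
  rw [← Measure.withDensity_rnDeriv_eq _ _ hac,
    withDensity_congr_ae (Measure.rnDeriv_restrict ν volume hA), withDensity_indicator hA]
  refine withDensity_congr_ae ?_
  have hae : ∀ᵐ x, Tendsto (fun r => ν (Metric.closedBall x r) / volume (Metric.closedBall x r))
      (𝓝[>] 0) (𝓝 (ν.rnDeriv volume x)) := Besicovitch.ae_tendsto_rnDeriv ν volume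
  filter_upwards [ae_restrict_of_ae hae, ae_restrict_of_ae (Measure.rnDeriv_lt_top ν volume),
    ae_restrict_mem hA] with x h1 h2 hx
  have := tendsto_nhds_unique (tendsto_lintegral_halfPlanePoisson ν h2.ne h1) (hlim x hx)
  rw [ENNReal.ofReal_div_of_pos Real.pi_pos, ← this, ENNReal.mul_div_cancel_right]
  · simpa using Real.pi_pos
  · exact ENNReal.ofReal_ne_top

/-! ### Herglotz representation -/

/-- A holomorphic function with values in the closed lower half-plane that takes a real value is
constant. -/
theorem eq_of_im_nonpos_of_im_eq_zero {f : ℂ → ℂ} (hf : DifferentiableOn ℂ f {z | 0 < z.im})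
    (him : ∀ z : ℂ, 0 < z.im → (f z).im ≤ 0) {z₀ : ℂ} (hz₀ : 0 < z₀.im) (h0 : (f z₀).im = 0)
    {z : ℂ} (hz : 0 < z.im) : f z = f z₀ := by
  rcases (hf.analyticOnNhd isOpen_upper).is_constant_or_isOpen isPreconnected_upper with
    ⟨w, hw⟩ | hopen
  · rw [hw z hz, hw z₀ hz₀]
  · exfalso
    have hnhds : f '' {z | 0 < z.im} ∈ 𝓝 (f z₀) :=
      (hopen _ subset_rfl isOpen_upper).mem_nhds ⟨z₀, hz₀, rfl⟩
    have ht : Tendsto (fun ε : ℝ => f z₀ + ε * Complex.I) (𝓝[>] 0) (𝓝 (f z₀)) := by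
      have : Continuous fun ε : ℝ => f z₀ + ε * Complex.I := by fun_prop
      simpa using (this.tendsto 0).mono_left nhdsWithin_le_nhds
    obtain ⟨ε, ⟨w, hw, hwε⟩, hε⟩ := ((ht.eventually hnhds).and self_mem_nhdsWithin).exists
    have hε' : (0 : ℝ) < ε := hε
    have := him w hw
    rw [hwε] at this
    simp [h0] at this
    linarith

/-- The Borel `σ`-algebra of the circle. -/
noncomputable instance instMeasurableSpaceCircle : MeasurableSpace Circle := borel Circle

instance instBorelSpaceCircle : BorelSpace Circle := ⟨rfl⟩

theorem continuous_circle_coe : Continuous fun ζ : Circle => (ζ : ℂ) := continuous_subtype_val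

/-- The Poisson kernel of the unit disc, as a continuous function on the circle. -/
noncomputable def circlePoisson (w : ℂ) (ζ : Circle) : ℝ := (herglotzRieszKernel 0 w ζ).re

theorem continuous_circlePoisson {w : ℂ} (hw : w ∈ Metric.ball (0 : ℂ) 1) :
    Continuous (circlePoisson w) := by
  have h := continuousOn_herglotzRieszKernel_sphere (c := 0) (R := 1) hw
  refine Complex.continuous_re.comp (h.comp_continuous continuous_circle_coe fun ζ => ?_)
  simp [Circle.norm_coe]

/-- Poisson's formula for `w ↦ f (R w)`, written with a measure on the unit circle so that the
kernel does not depend on `R`. -/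
theorem exists_circle_measure_of_radius {f : ℂ → ℂ} (hf : DifferentiableOn ℂ f (Metric.ball 0 1))
    (hre : ∀ w ∈ Metric.ball (0 : ℂ) 1, 0 ≤ (f w).re) {R : ℝ} (hR : R ∈ Ioo (0 : ℝ) 1) :
    ∃ m : FiniteMeasure Circle, ∀ w ∈ Metric.ball (0 : ℂ) 1,
      ∫ ζ, circlePoisson w ζ ∂(m : Measure Circle) = (f (R * w)).re := by
  have hball : ∀ w : ℂ, ‖w‖ ≤ 1 → (R : ℂ) * w ∈ Metric.ball (0 : ℂ) 1 := fun w hw => by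
    rw [mem_ball_zero_iff, norm_mul, Complex.norm_real, Real.norm_of_nonneg hR.1.le]
    nlinarith [hR.1, hR.2, norm_nonneg w]
  have hdiff : DifferentiableOn ℂ (fun w => f (R * w)) (closure (Metric.ball 0 1)) := by
    rw [closure_ball 0 one_ne_zero]
    exact hf.comp (by fun_prop) fun w hw => hball w (by simpa using hw)
  have hexp : ∀ θ : ℝ, circleMap 0 1 θ = Circle.exp θ := fun θ => by
    simp [circleMap, Circle.coe_exp]
  have hcont : Continuous fun θ : ℝ => f (R * Circle.exp θ) := by
    refine hf.continuousOn.comp_continuous (by fun_prop) fun θ => hball _ (by simp)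
  set d : ℝ → ℝ := fun θ => (2 * Real.pi)⁻¹ * (f (R * Circle.exp θ)).re with hd
  have hdc : Continuous d := by
    exact continuous_const.mul (Complex.continuous_re.comp hcont)
  have hd0 : ∀ θ, 0 ≤ d θ := fun θ =>
    mul_nonneg (by positivity) (hre _ (hball _ (by simp)))
  have hdi : IntegrableOn d (Ioc 0 (2 * Real.pi)) :=
    (hdc.integrableOn_Icc (a := 0) (b := 2 * Real.pi)).mono_set Ioc_subset_Icc_self
  have hfin : IsFiniteMeasure ((volume.restrict (Ioc 0 (2 * Real.pi))).withDensity
      fun θ => ENNReal.ofReal (d θ)) := isFiniteMeasure_withDensity_ofReal hdi.2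
  refine ⟨⟨((volume.restrict (Ioc 0 (2 * Real.pi))).withDensity
      fun θ => ENNReal.ofReal (d θ)).map Circle.exp, inferInstance⟩, fun w hw => ?_⟩
  have hP := continuous_circlePoisson hw
  simp only [FiniteMeasure.toMeasure_mk]
  rw [integral_map (by fun_prop) hP.aestronglyMeasurable,
    integral_withDensity_eq_integral_toReal_smul (by fun_prop) (by simp)]
  have key := congrArg Complex.re
    (hdiff.diffContOnCl.circleAverage_re_herglotzRieszKernel_smul hw)
  rw [← key, Real.circleAverage_def, intervalIntegral.integral_of_le (by positivity),
    Complex.smul_re, smul_eq_mul]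
  have hint : IntegrableOn (fun θ : ℝ => (Complex.re ∘ herglotzRieszKernel 0 w •
      fun w => f (R * w)) (circleMap 0 1 θ)) (Ioc 0 (2 * Real.pi)) := by
    have hc : Continuous (fun θ : ℝ => (Complex.re ∘ herglotzRieszKernel 0 w •
        fun w => f (R * w)) (circleMap 0 1 θ)) := by
      simp only [Pi.smul_apply', hexp, Function.comp_apply]
      exact (hP.comp (by fun_prop : Continuous Circle.exp)).smul hcont
    exact hc.integrableOn_Icc.mono_set Ioc_subset_Icc_self
  have hre' := integral_re (𝕜 := ℂ) hint
  refine Eq.trans ?_ (congrArg (fun t => (2 * Real.pi)⁻¹ * t) hre')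
  rw [← integral_const_mul]
  refine integral_congr_ae (Eventually.of_forall fun θ => ?_)
  have hθ := ENNReal.toReal_ofReal (hd0 θ)
  simp only [hd] at hθ
  simp only [hθ, hd, Pi.smul_apply', hexp, Function.comp_apply,
    circlePoisson, smul_eq_mul, RCLike.re_eq_complex_re, Complex.smul_re]
  ring

/-- **Herglotz' theorem** on the disc: a non-negative real part of a holomorphic function is the
Poisson integral of a finite measure on the circle. -/
theorem exists_circle_measure {f : ℂ → ℂ} (hf : DifferentiableOn ℂ f (Metric.ball 0 1))
    (hre : ∀ w ∈ Metric.ball (0 : ℂ) 1, 0 ≤ (f w).re) :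
    ∃ m : FiniteMeasure Circle, ∀ w ∈ Metric.ball (0 : ℂ) 1,
      ∫ ζ, circlePoisson w ζ ∂(m : Measure Circle) = (f w).re := by
  have hex : ∀ R : ℝ, ∃ m : FiniteMeasure Circle, R ∈ Ioo (0 : ℝ) 1 →
      ∀ w ∈ Metric.ball (0 : ℂ) 1,
        ∫ ζ, circlePoisson w ζ ∂(m : Measure Circle) = (f (R * w)).re := fun R => by
    by_cases hR : R ∈ Ioo (0 : ℝ) 1
    · obtain ⟨m, hm⟩ := exists_circle_measure_of_radius hf hre hR
      exact ⟨m, fun _ => hm⟩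
    · exact ⟨0, fun h => absurd h hR⟩
  choose m hm using hex
  let u : Ultrafilter ℝ := Ultrafilter.of (𝓝[<] 1)
  have hu : (u : Filter ℝ) ≤ 𝓝[<] 1 := Ultrafilter.of_le _
  have hIoo : ∀ᶠ R in (u : Filter ℝ), R ∈ Ioo (0 : ℝ) 1 := hu (Ioo_mem_nhdsLT one_pos)
  -- all the measures have the mass `Re f(0)`, so they stay in a compact set
  have hmass : ∀ᶠ R in (u : Filter ℝ), m R ∈ {ν : FiniteMeasure Circle |
      ν.mass = (f 0).re.toNNReal} := by
    filter_upwards [hIoo] with R hR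
    have h0 := hm R hR 0 (by simp)
    have h1 : ∀ ζ : Circle, circlePoisson 0 ζ = 1 := fun ζ => by
      simp [circlePoisson, herglotzRieszKernel_def]
    simp only [h1, mul_zero, integral_const, smul_eq_mul, mul_one] at h0
    change (m R).mass = _
    rw [← h0]
    exact Real.toNNReal_coe.symm
  obtain ⟨m₀, -, hm₀⟩ := (isCompact_setOfPred_finiteMeasure_eq_of_compactSpace Circle
    (f 0).re.toNNReal).ultrafilter_le_nhds (u.map m) (le_principal_iff.2 hmass)
  refine ⟨m₀, fun w hw => ?_⟩
  have ht : Tendsto m u (𝓝 m₀) := hm₀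
  have h1 := (FiniteMeasure.tendsto_iff_forall_integral_tendsto.1 ht)
    (BoundedContinuousFunction.mkOfCompact ⟨circlePoisson w, continuous_circlePoisson hw⟩)
  simp only [BoundedContinuousFunction.mkOfCompact_apply, ContinuousMap.coe_mk] at h1
  have h2 : Tendsto (fun R : ℝ => (f (R * w)).re) u (𝓝 (f w).re) := by
    have hc : ContinuousAt f w :=
      (hf.differentiableAt (Metric.isOpen_ball.mem_nhds hw)).continuousAt
    have hm : Tendsto (fun R : ℝ => (R : ℂ) * w) u (𝓝 w) := by
      have : Continuous fun R : ℝ => (R : ℂ) * w := by fun_prop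
      have := (this.tendsto 1).mono_left (hu.trans nhdsWithin_le_nhds)
      simpa using this
    exact (Complex.continuous_re.tendsto _).comp (hc.tendsto.comp hm)
  refine tendsto_nhds_unique h1 (h2.congr' ?_)
  filter_upwards [hIoo] with R hR
  exact (hm R hR w hw).symm

/-- The boundary coordinate of the Cayley transform, `ζ ↦ i (1 + ζ) / (1 - ζ)`; it is real on the
circle, and the point `ζ = 1` is sent to infinity by the transform (here to the junk value `0`). -/
noncomputable def cayleyCoord (ζ : Circle) : ℝ := (Complex.I * (1 + ζ) / (1 - ζ)).re

theorem measurable_cayleyCoord : Measurable cayleyCoord := by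
  unfold cayleyCoord
  have : Measurable fun ζ : Circle => (ζ : ℂ) := continuous_circle_coe.measurable
  fun_prop

theorem coe_eq_cayley {ζ : Circle} (hζ : ζ ≠ 1) :
    (ζ : ℂ) = (cayleyCoord ζ - Complex.I) / (cayleyCoord ζ + Complex.I) := by
  have h1 : (1 : ℂ) - ζ ≠ 0 := by
    rw [sub_ne_zero]
    exact fun h => hζ (Circle.ext (by simpa using h.symm))
  have hreal : Complex.I * (1 + ζ) / (1 - ζ) = (cayleyCoord ζ : ℂ) := by
    refine (Complex.conj_eq_iff_re.1 ?_).symm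
    have hc : (starRingEnd ℂ) (ζ : ℂ) = (ζ : ℂ)⁻¹ := by
      rw [← Circle.coe_inv_eq_conj, Circle.coe_inv]
    have h2 : (1 : ℂ) - (ζ : ℂ)⁻¹ ≠ 0 := by
      rw [← hc]
      intro h
      apply h1
      have := congrArg (starRingEnd ℂ) h
      simpa using this
    have h3 : (ζ : ℂ) ≠ 0 := Circle.coe_ne_zero ζ
    have h4 : (ζ : ℂ) - 1 ≠ 0 := by rwa [← neg_sub, neg_ne_zero]
    simp only [map_div₀, map_mul, map_add, map_sub, map_one, Complex.conj_I, hc]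
    rw [div_eq_div_iff h2 h1]
    field_simp
    ring
  have h5 : (cayleyCoord ζ : ℂ) + Complex.I ≠ 0 := fun h => by
    have := congrArg Complex.im h
    simp at this
  rw [eq_div_iff h5, ← hreal]
  field_simp
  ring

theorem cayley_mem_ball {z : ℂ} (hz : 0 < z.im) :
    (z - Complex.I) / (z + Complex.I) ∈ Metric.ball (0 : ℂ) 1 := by
  have h : z + Complex.I ≠ 0 := fun h => by
    have := congrArg Complex.im h
    simp at this
    linarith
  rw [mem_ball_zero_iff, norm_div, div_lt_one (norm_pos_iff.2 h),
    ← sq_lt_sq₀ (norm_nonneg _) (norm_nonneg _), ← Complex.normSq_eq_norm_sq,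
    ← Complex.normSq_eq_norm_sq]
  simp [Complex.normSq_apply]
  nlinarith

theorem circlePoisson_cayley {z : ℂ} (hz : 0 < z.im) {ζ : Circle} (hζ : ζ ≠ 1) :
    circlePoisson ((z - Complex.I) / (z + Complex.I)) ζ =
      (1 + cayleyCoord ζ ^ 2) * halfPlanePoisson z (cayleyCoord ζ) := by
  have h := congrFun (poissonKernel_eq_re_herglotzRieszKernel (c := 0)
    (w := (z - Complex.I) / (z + Complex.I))) ζ
  rw [circlePoisson, ← Function.comp_apply (f := Complex.re), ← h, poissonKernel_def,
    coe_eq_cayley hζ]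
  set k := cayleyCoord ζ
  have h1 : z + Complex.I ≠ 0 := fun h => by
    have := congrArg Complex.im h
    simp at this
    linarith
  have h2 : (k : ℂ) + Complex.I ≠ 0 := fun h => by
    have := congrArg Complex.im h
    simp at this
  have h3 : (k - Complex.I) / (k + Complex.I) - (z - Complex.I) / (z + Complex.I) =
      -(2 * Complex.I * (z - k)) / ((k + Complex.I) * (z + Complex.I)) := by
    field_simp
    ring
  simp only [sub_zero, ← Complex.normSq_eq_norm_sq]
  rw [h3]
  simp only [map_div₀, map_mul, Complex.normSq_neg]
  have e1 : Complex.normSq (k + Complex.I) = 1 + k ^ 2 := by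
    simp [Complex.normSq_apply]; ring
  have e2 : Complex.normSq (k - Complex.I) = 1 + k ^ 2 := by
    simp [Complex.normSq_apply]; ring
  have e3 : Complex.normSq (z - Complex.I) = Complex.normSq (z + Complex.I) - 4 * z.im := by
    simp [Complex.normSq_apply]; ring
  have e4 : Complex.normSq 2 = 4 := by norm_num [Complex.normSq_apply]
  have p1 := Complex.normSq_pos.2 h1
  have p2 : 0 < 1 + k ^ 2 := by positivity
  have p3 := Complex.normSq_pos.2 (sub_ofReal_ne_zero hz k)
  rw [e1, e2, e3, e4, Complex.normSq_I, halfPlanePoisson]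
  field_simp
  ring

theorem circlePoisson_cayley_one {z : ℂ} (hz : 0 < z.im) :
    circlePoisson ((z - Complex.I) / (z + Complex.I)) 1 = z.im := by
  have h1 : z + Complex.I ≠ 0 := fun h => by
    have := congrArg Complex.im h
    simp at this
    linarith
  have : herglotzRieszKernel 0 ((z - Complex.I) / (z + Complex.I)) (1 : Circle) =
      -(Complex.I * z) := by
    rw [herglotzRieszKernel_def]
    have h2 : (1 : ℂ) - (z - Complex.I) / (z + Complex.I) ≠ 0 := by
      rw [one_sub_div h1]
      simp [h1]
    simp only [sub_zero, Circle.coe_one]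
    rw [div_eq_iff h2]
    field_simp
    linear_combination (2 * z) * Complex.I_sq
  rw [circlePoisson, this]
  simp

/-- **Herglotz' theorem** on the upper half-plane: minus the imaginary part of a holomorphic
function with values in the closed lower half-plane is a linear function plus a Poisson integral. -/
theorem exists_halfPlane_measure {G : ℂ → ℂ} (hG : DifferentiableOn ℂ G {z | 0 < z.im})
    (him : ∀ z : ℂ, 0 < z.im → (G z).im ≤ 0) :
    ∃ (c : ENNReal) (ν : Measure ℝ), ∀ z : ℂ, 0 < z.im →
      ENNReal.ofReal (-(G z).im) =
        c * ENNReal.ofReal z.im + ∫⁻ x, ENNReal.ofReal (halfPlanePoisson z x) ∂ν := by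
  have hne : ∀ w ∈ Metric.ball (0 : ℂ) 1, (1 : ℂ) - w ≠ 0 := fun w hw h => by
    rw [sub_eq_zero] at h
    simp [← h] at hw
  have himc : ∀ w ∈ Metric.ball (0 : ℂ) 1, 0 < (Complex.I * (1 + w) / (1 - w)).im := by
    intro w hw
    have hpos := Complex.normSq_pos.2 (hne w hw)
    rw [mem_ball_zero_iff, ← sq_lt_one_iff₀ (norm_nonneg _), ← Complex.normSq_eq_norm_sq] at hw
    rw [Complex.div_im, ← sub_div]
    refine div_pos ?_ hpos
    simp [Complex.normSq_apply] at hw ⊢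
    nlinarith
  obtain ⟨m, hm⟩ := exists_circle_measure
    (f := fun w => Complex.I * G (Complex.I * (1 + w) / (1 - w)))
    ((hG.comp (by
      refine DifferentiableOn.div (by fun_prop) (by fun_prop) hne) himc).const_mul _)
    (fun w hw => by simpa using him _ (himc w hw))
  have hsingle : MeasurableSet ({1} : Set Circle) := measurableSet_singleton 1
  -- the mass at `ζ = 1`, the point at infinity, gives the linear term
  refine ⟨(m : Measure Circle) {1}, (((m : Measure Circle).restrict {1}ᶜ).withDensity
    fun ζ => ENNReal.ofReal (1 + cayleyCoord ζ ^ 2)).map cayleyCoord, fun z hz => ?_⟩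
  have hz1 : z + Complex.I ≠ 0 := fun h => by
    have := congrArg Complex.im h
    simp at this
    linarith
  have hw := cayley_mem_ball hz
  have hcay : Complex.I * (1 + (z - Complex.I) / (z + Complex.I)) /
      (1 - (z - Complex.I) / (z + Complex.I)) = z := by
    rw [div_eq_iff (hne _ hw)]
    field_simp
    ring
  have h := hm _ hw
  simp only [hcay, Complex.mul_re, Complex.I_re, zero_mul, Complex.I_im, one_mul, zero_sub] at h
  have hnonneg : ∀ ζ, 0 ≤ circlePoisson ((z - Complex.I) / (z + Complex.I)) ζ := fun ζ => by
    by_cases hζ : ζ = 1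
    · rw [hζ, circlePoisson_cayley_one hz]; exact hz.le
    · rw [circlePoisson_cayley hz hζ]
      exact mul_nonneg (by positivity) (halfPlanePoisson_nonneg hz.le _)
  have hcont := continuous_circlePoisson hw
  have hPm : Measurable fun x => ENNReal.ofReal (halfPlanePoisson z x) :=
    (continuous_halfPlanePoisson hz).measurable.ennreal_ofReal
  have hcm := measurable_cayleyCoord
  rw [← h, ofReal_integral_eq_lintegral_ofReal (hcont.integrable_of_hasCompactSupport
      (HasCompactSupport.of_compactSpace _)) (Eventually.of_forall hnonneg),
    ← lintegral_add_compl _ hsingle, lintegral_singleton, circlePoisson_cayley_one hz, mul_comm,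
    lintegral_map hPm hcm]
  have hwd := lintegral_withDensity_eq_lintegral_mul ((m : Measure Circle).restrict {1}ᶜ)
    (f := fun ζ => ENNReal.ofReal (1 + cayleyCoord ζ ^ 2)) (by fun_prop) (hPm.comp hcm)
  simp only [Function.comp_apply] at hwd
  rw [hwd]
  congr 1
  refine setLIntegral_congr_fun hsingle.compl fun ζ hζ => ?_
  simp only [Pi.mul_apply, circlePoisson_cayley hz hζ]
  rw [ENNReal.ofReal_mul (by positivity)]
  rfl

/-- A holomorphic function on the upper half-plane with values in the closed lower half-plane that
is asymptotic to `1 / z` along the imaginary axis is the Cauchy transform of a probability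
measure. -/
theorem exists_cauchyTransform_eq {G : ℂ → ℂ} (hG : DifferentiableOn ℂ G {z | 0 < z.im})
    (him : ∀ z : ℂ, 0 < z.im → (G z).im ≤ 0)
    (hlim : Tendsto (fun y : ℝ => (y * Complex.I) * G (y * Complex.I)) atTop (𝓝 1)) :
    ∃ ν : Measure ℝ, IsProbabilityMeasure ν ∧
      ∀ z : ℂ, 0 < z.im → cauchyTransform ν z = G z := by
  obtain ⟨c, ν, h⟩ := exists_halfPlane_measure hG him
  have hre : Tendsto (fun y : ℝ => ENNReal.ofReal (y * -(G (y * Complex.I)).im)) atTop (𝓝 1) := by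
    have := ENNReal.tendsto_ofReal ((Complex.continuous_re.tendsto _).comp hlim)
    simpa using this
  have hexp : ∀ y : ℝ, 0 < y → ENNReal.ofReal (y * -(G (y * Complex.I)).im) =
      c * ENNReal.ofReal (y ^ 2) +
        ∫⁻ x, ENNReal.ofReal (y * halfPlanePoisson (y * Complex.I) x) ∂ν := fun y hy => by
    rw [ENNReal.ofReal_mul hy.le, h _ (by simpa using hy), mul_add,
      ← lintegral_const_mul' _ _ ENNReal.ofReal_ne_top]
    simp_rw [← ENNReal.ofReal_mul hy.le]
    rw [mul_left_comm, ← ENNReal.ofReal_mul hy.le]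
    simp [sq]
  have hc : c = 0 := by
    by_contra hc
    have hinf : Tendsto (fun y : ℝ => c * ENNReal.ofReal (y ^ 2)) atTop (𝓝 ⊤) := by
      have h1 : Tendsto (fun y : ℝ => ENNReal.ofReal (y ^ 2)) atTop (𝓝 ⊤) :=
        ENNReal.tendsto_ofReal_atTop.comp (tendsto_pow_atTop two_ne_zero)
      have := ENNReal.Tendsto.const_mul (a := c) h1 (Or.inl ENNReal.top_ne_zero)
      rwa [ENNReal.mul_top hc] at this
    have hle : (⊤ : ENNReal) ≤ 1 := by
      refine le_of_tendsto_of_tendsto hinf hre ?_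
      filter_upwards [eventually_gt_atTop 0] with y hy
      rw [hexp y hy]
      exact le_self_add
    simp at hle
  -- `y ^ 2 / (x ^ 2 + y ^ 2)` increases to `1` as `y` tends to infinity
  have hmass : ν univ = 1 := by
    have hmono : Tendsto (fun n : ℕ => ∫⁻ x, ENNReal.ofReal
        (((n + 1 : ℕ) : ℝ) * halfPlanePoisson (((n + 1 : ℕ) : ℝ) * Complex.I) x) ∂ν) atTop
        (𝓝 (∫⁻ _, 1 ∂ν)) := by
      have hform : ∀ (y x : ℝ), y * halfPlanePoisson (y * Complex.I) x =
          y ^ 2 / (x ^ 2 + y ^ 2) := fun y x => by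
        have := halfPlanePoisson_add_mul_I 0 y x
        simp only [Complex.ofReal_zero, zero_add, zero_sub, neg_sq] at this
        rw [this]
        ring
      simp only [hform]
      refine lintegral_tendsto_of_tendsto_of_monotone (fun n => by fun_prop)
        (Eventually.of_forall fun x => ?_) (Eventually.of_forall fun x => ?_)
      · intro a b hab
        have ha : (0 : ℝ) < (a + 1 : ℕ) := by positivity
        have hab' : ((a + 1 : ℕ) : ℝ) ≤ (b + 1 : ℕ) := by exact_mod_cast Nat.succ_le_succ hab
        have hb := ha.trans_le hab'
        refine ENNReal.ofReal_le_ofReal ?_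
        rw [div_le_div_iff₀ (by positivity) (by positivity)]
        have : ((a + 1 : ℕ) : ℝ) ^ 2 ≤ ((b + 1 : ℕ) : ℝ) ^ 2 := by gcongr
        nlinarith [sq_nonneg x]
      · have h1 : Tendsto (fun y : ℝ => 1 - x ^ 2 / (x ^ 2 + y ^ 2)) atTop (𝓝 (1 - 0)) := by
          refine tendsto_const_nhds.sub (tendsto_const_nhds.div_atTop ?_)
          exact tendsto_atTop_add_const_left _ _ (tendsto_pow_atTop two_ne_zero)
        rw [sub_zero] at h1
        have h2 : Tendsto (fun n : ℕ => ((n + 1 : ℕ) : ℝ)) atTop atTop :=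
          tendsto_natCast_atTop_atTop.comp (tendsto_add_atTop_nat 1)
        have h3 := ENNReal.tendsto_ofReal (h1.comp h2)
        rw [ENNReal.ofReal_one] at h3
        refine h3.congr fun n => ?_
        have : (0 : ℝ) < (n + 1 : ℕ) := by positivity
        simp only [Function.comp_apply]
        congr 1
        field_simp
        ring
    have h2 : Tendsto (fun n : ℕ => ((n + 1 : ℕ) : ℝ)) atTop atTop :=
      tendsto_natCast_atTop_atTop.comp (tendsto_add_atTop_nat 1)
    have := tendsto_nhds_unique (hmono.congr fun n => ?_) (hre.comp h2)
    · simpa using this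
    · rw [Function.comp_apply, hexp _ (by positivity), hc, zero_mul, zero_add]
  have hprob : IsProbabilityMeasure ν := ⟨hmass⟩
  refine ⟨ν, hprob, ?_⟩
  -- both functions have the same imaginary part, so they differ by a real constant
  have hsub : ∀ z : ℂ, 0 < z.im → (cauchyTransform ν z - G z).im = 0 := fun z hz => by
    have h1 := ofReal_neg_cauchyTransform_im ν hz
    have h2 := h z hz
    rw [hc, zero_mul, zero_add, ← h1, ENNReal.ofReal_eq_ofReal_iff (by linarith [him z hz])
      (by linarith [cauchyTransform_im_neg ν hz])] at h2
    rw [Complex.sub_im]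
    linarith
  have hI : ∀ y : ℝ, 0 < y → 0 < (y * Complex.I : ℂ).im := fun y hy => by simpa using hy
  have hconst : ∀ z : ℂ, 0 < z.im →
      cauchyTransform ν z - G z = cauchyTransform ν Complex.I - G Complex.I := fun z hz =>
    eq_of_im_nonpos_of_im_eq_zero (f := fun z => cauchyTransform ν z - G z)
      ((differentiableOn_cauchyTransform_upper ν).sub hG)
      (fun z hz => (hsub z hz).le) (z₀ := Complex.I) (by simp) (hsub _ (by simp)) hz
  set k := cauchyTransform ν Complex.I - G Complex.I
  -- and the constant vanishes at infinity
  have hk : k = 0 := by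
    have hinv : Tendsto (fun y : ℝ => (y * Complex.I : ℂ)⁻¹) atTop (𝓝 0) := by
      rw [tendsto_zero_iff_norm_tendsto_zero]
      simp only [norm_inv, norm_mul, Complex.norm_real, Complex.norm_I, mul_one]
      exact tendsto_inv_atTop_zero.comp tendsto_abs_atTop_atTop
    have h0 := hinv.mul ((tendsto_mul_cauchyTransform_atTop ν).sub hlim)
    simp only [sub_self, mul_zero] at h0
    refine tendsto_nhds_unique (tendsto_const_nhds.congr' ?_) h0
    filter_upwards [eventually_gt_atTop 0] with y hy
    have hy0 : (y : ℂ) * Complex.I ≠ 0 := by simp [hy.ne']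
    rw [← mul_sub, hconst _ (hI y hy), inv_mul_cancel_left₀ hy0]
  intro z hz
  have := hconst z hz
  rwa [hk, sub_eq_zero] at this

/-! ### Multiplicative Boolean powers -/

/-- The self-energy `K_μ(z) = z - F_μ(z)`. -/
noncomputable def selfEnergy (μ : Measure ℝ) (z : ℂ) : ℂ := z - fTransform μ z

theorem etaTransform_div (μ : Measure ℝ) {z : ℂ} (hz : z ≠ 0) :
    etaTransform μ z / z = selfEnergy μ z⁻¹ := by
  rw [etaTransform, selfEnergy]
  field_simp

/-- In terms of the self-energy, the multiplicative Boolean power is a plain power. -/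
theorem isMultBooleanPower_iff {μ ν : Measure ℝ} {t : ℝ} :
    IsMultBooleanPower μ t ν ↔ IsProbabilityMeasure ν ∧ ν (Iio 0) = 0 ∧
      ∀ x : ℝ, x < 0 → selfEnergy ν x = selfEnergy μ x ^ (t : ℂ) := by
  refine and_congr_right fun _ => and_congr_right fun _ => ⟨fun h x hx => ?_, fun h x hx => ?_⟩
  · have hx' : ((x⁻¹ : ℝ) : ℂ) ≠ 0 := by simpa using hx.ne
    have := h x⁻¹ (inv_lt_zero.2 hx)
    rwa [etaTransform_div _ hx', etaTransform_div _ hx', Complex.ofReal_inv, inv_inv] at this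
  · have hx' : (x : ℂ) ≠ 0 := by simpa using hx.ne
    rw [etaTransform_div _ hx', etaTransform_div _ hx', ← Complex.ofReal_inv]
    exact h x⁻¹ (inv_lt_zero.2 hx)

theorem selfEnergy_im_nonpos (μ : Measure ℝ) [IsProbabilityMeasure μ] {z : ℂ} (hz : 0 < z.im) :
    (selfEnergy μ z).im ≤ 0 := by
  rw [selfEnergy, Complex.sub_im, sub_nonpos]
  exact im_le_fTransform_im μ hz

theorem differentiableOn_selfEnergy_upper (μ : Measure ℝ) [IsProbabilityMeasure μ] :
    DifferentiableOn ℂ (selfEnergy μ) {z | 0 < z.im} :=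
  differentiableOn_id.sub (differentiableOn_fTransform_upper μ)

section NegativeAxis

variable {μ : Measure ℝ} [IsProbabilityMeasure μ]

theorem exists_cauchyTransform_ofReal_neg (hμ : μ (Iio 0) = 0) {x : ℝ} (hx : x < 0) :
    ∃ g : ℝ, 0 < g ∧ g ≤ (-x)⁻¹ ∧ cauchyTransform μ x = ((-g : ℝ) : ℂ) := by
  have hae : ∀ᵐ u ∂μ, 0 ≤ u := by
    rw [ae_iff]
    simp only [not_le]
    exact hμ
  have hbd : ∀ᵐ u ∂μ, 0 < (u - x)⁻¹ ∧ (u - x)⁻¹ ≤ (-x)⁻¹ := by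
    filter_upwards [hae] with u hu
    exact ⟨inv_pos.2 (by linarith), inv_anti₀ (by linarith) (by linarith)⟩
  have hint : Integrable (fun u : ℝ => (u - x)⁻¹) μ := by
    refine Integrable.of_bound (by fun_prop) (-x)⁻¹ ?_
    filter_upwards [hbd] with u hu
    rw [Real.norm_of_nonneg hu.1.le]
    exact hu.2
  refine ⟨∫ u, (u - x)⁻¹ ∂μ, ?_, ?_, ?_⟩
  · rw [integral_pos_iff_support_of_nonneg_ae (hbd.mono fun u hu => hu.1.le) hint]
    have : Function.support (fun u : ℝ => (u - x)⁻¹) =ᵐ[μ] univ := by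
      refine eventuallyEq_univ.2 ?_
      filter_upwards [hbd] with u hu
      exact hu.1.ne'
    rw [measure_congr this]
    simp
  · have := integral_mono_ae hint (integrable_const (-x)⁻¹) (hbd.mono fun u hu => hu.2)
    simpa using this
  · rw [cauchyTransform, ← integral_neg, ← integral_complex_ofReal]
    refine integral_congr_ae (Eventually.of_forall fun u => ?_)
    simp only
    rw [← inv_neg, neg_sub]
    push_cast
    rfl

theorem cauchyTransform_ofReal_neg_ne_zero (hμ : μ (Iio 0) = 0) {x : ℝ} (hx : x < 0) :
    cauchyTransform μ x ≠ 0 := by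
  obtain ⟨g, hg, -, h⟩ := exists_cauchyTransform_ofReal_neg hμ hx
  rw [h, Complex.ofReal_ne_zero]
  linarith

theorem exists_selfEnergy_ofReal_neg (hμ : μ (Iio 0) = 0) {x : ℝ} (hx : x < 0) :
    ∃ k : ℝ, 0 ≤ k ∧ selfEnergy μ x = (k : ℂ) := by
  obtain ⟨g, hg, hg', h⟩ := exists_cauchyTransform_ofReal_neg hμ hx
  refine ⟨x + g⁻¹, ?_, ?_⟩
  · have := inv_anti₀ hg hg'
    rw [inv_inv] at this
    linarith
  · rw [selfEnergy, fTransform, h]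
    push_cast
    rw [inv_neg, sub_neg_eq_add]

theorem tendsto_vertical (x : ℝ) :
    Tendsto (fun y : ℝ => (x : ℂ) + y * Complex.I) (𝓝[>] 0) (𝓝 x) := by
  have : Continuous fun y : ℝ => (x : ℂ) + y * Complex.I := by fun_prop
  simpa using (this.tendsto 0).mono_left nhdsWithin_le_nhds

theorem tendsto_cauchyTransform_vertical (hμ : μ (Iio 0) = 0) {x : ℝ} (hx : x < 0) :
    Tendsto (fun y : ℝ => cauchyTransform μ (x + y * Complex.I)) (𝓝[>] 0)
      (𝓝 (cauchyTransform μ x)) := by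
  have hmem : -(x : ℂ) ∈ Complex.slitPlane := by
    left
    simpa using hx
  exact (differentiableAt_cauchyTransform
    (notMem_image_support_of_neg_mem_slitPlane hμ hmem)).continuousAt.tendsto.comp
    (tendsto_vertical x)

theorem tendsto_selfEnergy_vertical (hμ : μ (Iio 0) = 0) {x : ℝ} (hx : x < 0) :
    Tendsto (fun y : ℝ => selfEnergy μ (x + y * Complex.I)) (𝓝[>] 0) (𝓝 (selfEnergy μ x)) :=
  (tendsto_vertical x).sub ((tendsto_cauchyTransform_vertical hμ hx).inv₀
    (cauchyTransform_ofReal_neg_ne_zero hμ hx))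

/-- The Cauchy transform of a measure on `[0, ∞)` is determined on the upper half-plane by its
values on the negative axis. -/
theorem cauchyTransform_eq_of_eq_on_neg {ν : Measure ℝ} [IsProbabilityMeasure ν]
    (hμ : μ (Iio 0) = 0) (hν : ν (Iio 0) = 0)
    (h : ∀ x : ℝ, x < 0 → cauchyTransform μ x = cauchyTransform ν x) {z : ℂ} (hz : 0 < z.im) :
    cauchyTransform μ z = cauchyTransform ν z := by
  have han : ∀ {ρ : Measure ℝ} [IsProbabilityMeasure ρ], ρ (Iio 0) = 0 →
      AnalyticOnNhd ℂ (fun w => cauchyTransform ρ (-w)) Complex.slitPlane := fun {ρ} _ hρ => by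
    refine DifferentiableOn.analyticOnNhd (fun w hw => ?_) Complex.isOpen_slitPlane
    refine DifferentiableAt.differentiableWithinAt ?_
    exact DifferentiableAt.comp (g := cauchyTransform ρ) w (differentiableAt_cauchyTransform
      (notMem_image_support_of_neg_mem_slitPlane hρ (by simpa using hw)))
      (differentiableAt_id.neg)
  have hfreq : ∃ᶠ w in 𝓝[≠] (1 : ℂ), cauchyTransform μ (-w) = cauchyTransform ν (-w) := by
    have ht : Tendsto (fun s : ℝ => (s : ℂ)) (𝓝[≠] 1) (𝓝[≠] (1 : ℂ)) := by
      refine tendsto_nhdsWithin_iff.2 ⟨?_, ?_⟩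
      · exact (Complex.continuous_ofReal.tendsto' 1 1 (by simp)).mono_left nhdsWithin_le_nhds
      · filter_upwards [self_mem_nhdsWithin] with s hs
        simpa using hs
    refine ht.frequently (Eventually.frequently ?_)
    filter_upwards [mem_nhdsWithin_of_mem_nhds (Ioi_mem_nhds (zero_lt_one' ℝ))] with s hs
    have := h (-s) (neg_lt_zero.2 hs)
    simpa using this
  have := AnalyticOnNhd.eqOn_of_preconnected_of_frequently_eq (han hμ) (han hν)
    (Complex.starConvex_one_slitPlane.isPathConnected
      Complex.one_mem_slitPlane).isConnected.isPreconnected (z₀ := 1) (by simp) hfreq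
    (x := -z) (Or.inr (by simpa using hz.ne'))
  simpa using this

end NegativeAxis

theorem cpow_ofReal_im_nonpos {k : ℂ} (hk : k.im ≤ 0) (hk' : k ∈ Complex.slitPlane) {t : ℝ}
    (ht : t ∈ Ioc (0 : ℝ) 1) : (k ^ (t : ℂ)).im ≤ 0 := by
  rw [Complex.cpow_ofReal_im]
  have h1 : k.arg ≤ 0 := by
    rcases hk.lt_or_eq with h | h
    · exact (Complex.arg_neg_iff.2 h).le
    · rcases Complex.mem_slitPlane_iff.1 hk' with h' | h'
      · exact (Complex.arg_eq_zero_iff.2 ⟨h'.le, h⟩).le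
      · exact absurd h h'
  have h2 : -Real.pi ≤ k.arg := (Complex.neg_pi_lt_arg k).le
  refine mul_nonpos_of_nonneg_of_nonpos (by positivity)
    (Real.sin_nonpos_of_nonpos_of_neg_pi_le ?_ ?_)
  · exact mul_nonpos_of_nonpos_of_nonneg h1 ht.1.le
  · nlinarith [ht.1, ht.2]

section Existence

variable {μ : Measure ℝ} [IsProbabilityMeasure μ]

/-- If `F_μ` tends to `0` at the boundary point `1`, then `K_μ` avoids the half-line `(-∞, 0]` on
the upper half-plane: a real value would make it constant, and the constant would be `1`. -/
theorem selfEnergy_mem_slitPlane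
    (h1 : Tendsto (fun y : ℝ => fTransform μ ((1 : ℝ) + y * Complex.I)) (𝓝[>] 0) (𝓝 0))
    {z : ℂ} (hz : 0 < z.im) : selfEnergy μ z ∈ Complex.slitPlane := by
  by_cases him : (selfEnergy μ z).im = 0
  · have hlim : Tendsto (fun y : ℝ => selfEnergy μ ((1 : ℝ) + y * Complex.I)) (𝓝[>] 0)
        (𝓝 (((1 : ℝ) : ℂ) - 0)) := (tendsto_vertical 1).sub h1
    have hconst : (fun y : ℝ => selfEnergy μ ((1 : ℝ) + y * Complex.I)) =ᶠ[𝓝[>] 0]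
        fun _ => selfEnergy μ z := by
      filter_upwards [self_mem_nhdsWithin] with y hy
      exact eq_of_im_nonpos_of_im_eq_zero (differentiableOn_selfEnergy_upper μ)
        (fun _ h => selfEnergy_im_nonpos μ h) hz him (by simpa using hy)
    have : selfEnergy μ z = 1 := by
      simpa using tendsto_nhds_unique (tendsto_const_nhds.congr' hconst.symm) hlim
    rw [this]
    simp
  · exact Or.inr him

theorem im_le_sub_selfEnergy_cpow_im
    (h1 : Tendsto (fun y : ℝ => fTransform μ ((1 : ℝ) + y * Complex.I)) (𝓝[>] 0) (𝓝 0))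
    {t : ℝ} (ht : t ∈ Ioc (0 : ℝ) 1) {z : ℂ} (hz : 0 < z.im) :
    z.im ≤ (z - selfEnergy μ z ^ (t : ℂ)).im := by
  rw [Complex.sub_im]
  linarith [cpow_ofReal_im_nonpos (selfEnergy_im_nonpos μ hz) (selfEnergy_mem_slitPlane h1 hz) ht]

/-- There is a probability measure with self-energy `K_μ ^ t` on the upper half-plane. -/
theorem exists_measure_fTransform_eq
    (h1 : Tendsto (fun y : ℝ => fTransform μ ((1 : ℝ) + y * Complex.I)) (𝓝[>] 0) (𝓝 0))
    {t : ℝ} (ht : t ∈ Ioc (0 : ℝ) 1) :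
    ∃ ν : Measure ℝ, IsProbabilityMeasure ν ∧ ∀ z : ℂ, 0 < z.im →
      fTransform ν z = z - selfEnergy μ z ^ (t : ℂ) := by
  have him := fun (z : ℂ) (hz : 0 < z.im) => im_le_sub_selfEnergy_cpow_im h1 ht hz
  have hne : ∀ z : ℂ, 0 < z.im → z - selfEnergy μ z ^ (t : ℂ) ≠ 0 := fun z hz h0 => by
    have := him z hz
    rw [h0] at this
    simp at this
    linarith
  suffices h : ∃ ν : Measure ℝ, IsProbabilityMeasure ν ∧
      ∀ z : ℂ, 0 < z.im → cauchyTransform ν z = (z - selfEnergy μ z ^ (t : ℂ))⁻¹ by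
    obtain ⟨ν, hν, h⟩ := h
    exact ⟨ν, hν, fun z hz => by rw [fTransform, h z hz, inv_inv]⟩
  refine exists_cauchyTransform_eq (G := fun z => (z - selfEnergy μ z ^ (t : ℂ))⁻¹) ?_ ?_ ?_
  · exact (differentiableOn_id.sub ((differentiableOn_selfEnergy_upper μ).cpow
      (differentiableOn_const _) fun z hz => selfEnergy_mem_slitPlane h1 hz)).inv hne
  · intro z hz
    rw [Complex.inv_im]
    exact div_nonpos_of_nonpos_of_nonneg (by linarith [him z hz]) (Complex.normSq_nonneg _)
  · have hK : Tendsto (fun y : ℝ => selfEnergy μ (y * Complex.I) ^ (t : ℂ) / (y * Complex.I))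
        atTop (𝓝 0) := by
      have hK1 : Tendsto (fun y : ℝ => 1 - fTransform μ (y * Complex.I) / (y * Complex.I)) atTop
          (𝓝 (1 - 1)) := tendsto_const_nhds.sub (tendsto_fTransform_div_atTop μ)
      have hbound : Tendsto (fun y : ℝ => y⁻¹ +
          ‖1 - fTransform μ (y * Complex.I) / (y * Complex.I)‖) atTop (𝓝 0) := by
        simpa using tendsto_inv_atTop_zero.add hK1.norm
      refine squeeze_zero_norm' ?_ hbound
      filter_upwards [eventually_gt_atTop 0] with y hy
      have hy0 : (y : ℂ) * Complex.I ≠ 0 := by simp [hy.ne']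
      have e : 1 - fTransform μ (y * Complex.I) / (y * Complex.I) =
          selfEnergy μ (y * Complex.I) / (y * Complex.I) := by
        rw [selfEnergy, sub_div, div_self hy0]
      rw [e, norm_div, norm_div, Complex.norm_cpow_real]
      have hn : ‖(y : ℂ) * Complex.I‖ = y := by simp [abs_of_pos hy]
      rw [hn, inv_eq_one_div, ← add_div]
      gcongr
      set a := ‖selfEnergy μ (y * Complex.I)‖
      have ha : 0 ≤ a := norm_nonneg _
      rcases le_total a 1 with h | h
      · linarith [Real.rpow_le_one ha h ht.1.le]
      · have := Real.rpow_le_rpow_of_exponent_le h ht.2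
        rw [Real.rpow_one] at this
        linarith
    have := ((tendsto_const_nhds (x := (1 : ℂ))).sub hK).inv₀ (by simp)
    simp only [sub_zero, inv_one] at this
    refine this.congr' ?_
    filter_upwards [eventually_gt_atTop 0] with y hy
    have hy0 : (y : ℂ) * Complex.I ≠ 0 := by simp [hy.ne']
    rw [one_sub_div hy0, inv_div, div_eq_mul_inv]

theorem exists_isMultBooleanPower (hμ : μ (Iio 0) = 0)
    (h1 : Tendsto (fun y : ℝ => fTransform μ ((1 : ℝ) + y * Complex.I)) (𝓝[>] 0) (𝓝 0))
    {t : ℝ} (ht : t ∈ Ioc (0 : ℝ) 1) :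
    ∃ ν : Measure ℝ, IsMultBooleanPower μ t ν ∧ ∀ z : ℂ, 0 < z.im →
      fTransform ν z = z - selfEnergy μ z ^ (t : ℂ) := by
  obtain ⟨ν, hν, hF⟩ := exists_measure_fTransform_eq h1 ht
  -- on the negative axis the boundary values of `F_ν` are real and negative
  have hreal : ∀ x : ℝ, x < 0 → ∃ a : ℝ, a < 0 ∧ (x : ℂ) - selfEnergy μ x ^ (t : ℂ) = (a : ℂ) := by
    intro x hx
    obtain ⟨k, hk, hKx⟩ := exists_selfEnergy_ofReal_neg hμ hx
    refine ⟨x - k ^ t, ?_, ?_⟩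
    · have := Real.rpow_nonneg hk t
      linarith
    · rw [hKx, ← Complex.ofReal_cpow hk]
      push_cast
      rfl
  have hlim : ∀ x : ℝ, x < 0 → Tendsto (fun y : ℝ => cauchyTransform ν (x + y * Complex.I))
      (𝓝[>] 0) (𝓝 ((x : ℂ) - selfEnergy μ x ^ (t : ℂ))⁻¹) := fun x hx => by
    obtain ⟨k, hk, hKx⟩ := exists_selfEnergy_ofReal_neg hμ hx
    obtain ⟨a, ha, hax⟩ := hreal x hx
    have hne : (x : ℂ) - selfEnergy μ x ^ (t : ℂ) ≠ 0 := by
      rw [hax, Complex.ofReal_ne_zero]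
      exact ha.ne
    have hc : ContinuousAt (fun w : ℂ => w ^ (t : ℂ)) (selfEnergy μ x) :=
      Complex.continuousAt_cpow_const_of_re_pos (Or.inl (by simpa [hKx] using hk))
        (by simpa using ht.1)
    refine (((tendsto_vertical x).sub
      (hc.tendsto.comp (tendsto_selfEnergy_vertical hμ hx))).inv₀ hne).congr' ?_
    filter_upwards [self_mem_nhdsWithin] with y hy
    have := hF (x + y * Complex.I) (by simpa using hy)
    simp only [Function.comp_apply]
    rw [← this, fTransform, inv_inv]
  have hν0 : ν (Iio 0) = 0 := by
    have h := restrict_eq_withDensity_of_tendsto_cauchyTransform ν measurableSet_Iio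
      (fun x hx => hlim x hx)
    rw [← Measure.restrict_apply_univ, h, withDensity_apply _ MeasurableSet.univ,
      Measure.restrict_univ]
    rw [setLIntegral_congr_fun (g := fun _ => 0) measurableSet_Iio fun x hx => ?_, lintegral_zero]
    obtain ⟨a, -, hax⟩ := hreal x hx
    simp only [hax, ← Complex.ofReal_inv, Complex.ofReal_im, neg_zero, zero_div,
      ENNReal.ofReal_zero]
  refine ⟨ν, isMultBooleanPower_iff.2 ⟨hν, hν0, fun x hx => ?_⟩, hF⟩
  rw [selfEnergy, fTransform,
    tendsto_nhds_unique (tendsto_cauchyTransform_vertical hν0 hx) (hlim x hx), inv_inv,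
    sub_sub_cancel]

theorem isMultBooleanPower_multBooleanPower (hμ : μ (Iio 0) = 0)
    (h1 : Tendsto (fun y : ℝ => fTransform μ ((1 : ℝ) + y * Complex.I)) (𝓝[>] 0) (𝓝 0))
    {t : ℝ} (ht : t ∈ Ioc (0 : ℝ) 1) : IsMultBooleanPower μ t (multBooleanPower μ t) := by
  have h : ∃ ν, IsMultBooleanPower μ t ν :=
    (exists_isMultBooleanPower hμ h1 ht).imp fun _ h => h.1
  rw [multBooleanPower, dif_pos h]
  exact h.choose_spec

/-- The defining relation on the negative axis determines `F_ν` on the upper half-plane, for every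
version `ν` of the multiplicative Boolean power. -/
theorem fTransform_of_isMultBooleanPower (hμ : μ (Iio 0) = 0)
    (h1 : Tendsto (fun y : ℝ => fTransform μ ((1 : ℝ) + y * Complex.I)) (𝓝[>] 0) (𝓝 0))
    {t : ℝ} (ht : t ∈ Ioc (0 : ℝ) 1) {ν : Measure ℝ} (hν : IsMultBooleanPower μ t ν) {z : ℂ}
    (hz : 0 < z.im) : fTransform ν z = z - selfEnergy μ z ^ (t : ℂ) := by
  obtain ⟨ν', hν', hF⟩ := exists_isMultBooleanPower hμ h1 ht
  rw [← hF z hz, fTransform, fTransform, inv_inj]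
  obtain ⟨i, hi, h⟩ := isMultBooleanPower_iff.1 hν
  obtain ⟨i', hi', h'⟩ := isMultBooleanPower_iff.1 hν'
  refine cauchyTransform_eq_of_eq_on_neg hi hi' (fun x hx => ?_) hz
  have := (h x hx).trans (h' x hx).symm
  rwa [selfEnergy, selfEnergy, sub_right_inj, fTransform, fTransform, inv_inj] at this

end Existence

/-! ### The Boolean stable law -/

/-- The reciprocal Cauchy transform `z + r e^{iαρπ} z^{1-α}` of the Boolean stable law. -/
noncomputable def stableF (α ρ r : ℝ) (z : ℂ) : ℂ :=
  z + (r : ℂ) * Complex.exp (Complex.I * (α * ρ * Real.pi : ℝ)) * z ^ ((1 - α : ℝ) : ℂ)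

theorem stableF_re (α ρ r : ℝ) (z : ℂ) : (stableF α ρ r z).re =
    z.re + r * ‖z‖ ^ (1 - α) * Real.cos (α * ρ * Real.pi + z.arg * (1 - α)) := by
  rw [stableF, mul_comm Complex.I]
  simp only [Complex.add_re, Complex.mul_re, Complex.mul_im, Complex.cpow_ofReal_re,
    Complex.cpow_ofReal_im, Complex.exp_ofReal_mul_I_re, Complex.exp_ofReal_mul_I_im,
    Complex.ofReal_re, Complex.ofReal_im, Real.cos_add]
  ring

theorem stableF_im (α ρ r : ℝ) (z : ℂ) : (stableF α ρ r z).im =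
    z.im + r * ‖z‖ ^ (1 - α) * Real.sin (α * ρ * Real.pi + z.arg * (1 - α)) := by
  rw [stableF, mul_comm Complex.I]
  simp only [Complex.add_im, Complex.mul_re, Complex.mul_im, Complex.cpow_ofReal_re,
    Complex.cpow_ofReal_im, Complex.exp_ofReal_mul_I_re, Complex.exp_ofReal_mul_I_im,
    Complex.ofReal_re, Complex.ofReal_im, Real.sin_add]
  ring

/-- Polar form of the values of `stableF` on the positive axis. -/
theorem stableF_ofReal_pos (α ρ r : ℝ) {x : ℝ} (hx : 0 < x) :
    (stableF α ρ r x).re = x + r * x ^ (1 - α) * Real.cos (α * ρ * Real.pi) ∧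
      (stableF α ρ r x).im = r * x ^ (1 - α) * Real.sin (α * ρ * Real.pi) := by
  rw [stableF_re, stableF_im, Complex.arg_ofReal_of_nonneg hx.le]
  simp [abs_of_pos hx]

/-- The reflection `x ↦ -x` exchanges `ρ` and `1 - ρ`. -/
theorem stableF_ofReal_neg (α ρ r : ℝ) {x : ℝ} (hx : x < 0) :
    (stableF α ρ r x).re = -(stableF α (1 - ρ) r (-x : ℝ)).re ∧
      (stableF α ρ r x).im = (stableF α (1 - ρ) r (-x : ℝ)).im := by
  have e : α * ρ * Real.pi + Real.pi * (1 - α) = Real.pi - α * (1 - ρ) * Real.pi := by ring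
  obtain ⟨h1, h2⟩ := stableF_ofReal_pos α (1 - ρ) r (neg_pos.2 hx)
  rw [h1, h2, stableF_re, stableF_im, Complex.arg_ofReal_of_neg hx, e, Real.cos_pi_sub,
    Real.sin_pi_sub]
  simp [abs_of_neg hx]
  ring

section

variable {α ρ r : ℝ}

/-- For `Im z ≥ 0` the argument of `e^{iαρπ} z^{1-α}` lies in `[0, π]`. -/
theorem stableF_im_ge (hα : α ∈ Ioo (0 : ℝ) 1) (hρ : ρ ∈ Icc (0 : ℝ) 1) (hr : 0 < r) {z : ℂ}
    (hz : 0 ≤ z.im) : z.im ≤ (stableF α ρ r z).im := by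
  rw [stableF_im]
  have h1 := Complex.arg_nonneg_iff.2 hz
  have h2 := Complex.arg_le_pi z
  have h3 : 0 ≤ 1 - α := by linarith [hα.2]
  have h4 : 0 ≤ α * ρ := mul_nonneg hα.1.le hρ.1
  have h5 : α * ρ ≤ α := mul_le_of_le_one_right hα.1.le hρ.2
  have hsin : 0 ≤ Real.sin (α * ρ * Real.pi + z.arg * (1 - α)) := by
    refine Real.sin_nonneg_of_nonneg_of_le_pi ?_ ?_
    · have := Real.pi_pos.le
      positivity
    · have a1 : z.arg * (1 - α) ≤ Real.pi * (1 - α) := by gcongr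
      have a2 : α * ρ * Real.pi ≤ α * Real.pi := by gcongr
      linarith
  have := mul_nonneg (mul_nonneg hr.le (Real.rpow_nonneg (norm_nonneg z) (1 - α))) hsin
  linarith

theorem stableF_ofReal_pos_ne_zero (hα : α ∈ Ioo (0 : ℝ) 1) (hρ : ρ ∈ Icc (0 : ℝ) 1) (hr : 0 < r)
    {x : ℝ} (hx : 0 < x) : stableF α ρ r x ≠ 0 := fun h => by
  obtain ⟨h1, h2⟩ := stableF_ofReal_pos α ρ r hx
  rw [h] at h1 h2
  have hp : 0 < r * x ^ (1 - α) := mul_pos hr (Real.rpow_pos_of_pos hx _)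
  have hsin : Real.sin (α * ρ * Real.pi) = 0 := by
    rcases mul_eq_zero.1 h2.symm with h | h
    · exact absurd h hp.ne'
    · exact h
  have h4 : 0 ≤ α * ρ := mul_nonneg hα.1.le hρ.1
  have h5 : α * ρ < 1 := (mul_le_of_le_one_right hα.1.le hρ.2).trans_lt hα.2
  have hzero : α * ρ * Real.pi = 0 := by
    by_contra hne
    have h0 : 0 < α * ρ * Real.pi :=
      lt_of_le_of_ne (mul_nonneg h4 Real.pi_pos.le) (Ne.symm hne)
    have := Real.sin_pos_of_pos_of_lt_pi h0 (by nlinarith [Real.pi_pos])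
    linarith
  rw [hzero, Real.cos_zero, mul_one, Complex.zero_re] at h1
  linarith

theorem stableF_ofReal_ne_zero (hα : α ∈ Ioo (0 : ℝ) 1) (hρ : ρ ∈ Icc (0 : ℝ) 1) (hr : 0 < r)
    {x : ℝ} (hx : x ≠ 0) : stableF α ρ r x ≠ 0 := by
  rcases hx.lt_or_gt with hx | hx
  · intro h
    obtain ⟨h1, h2⟩ := stableF_ofReal_neg α ρ r hx
    refine stableF_ofReal_pos_ne_zero (ρ := 1 - ρ) hα ⟨by linarith [hρ.2], by linarith [hρ.1]⟩ hr
      (neg_pos.2 hx) (Complex.ext ?_ ?_)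
    · rw [h] at h1
      simpa using h1.symm
    · rw [h] at h2
      exact h2.symm
  · exact stableF_ofReal_pos_ne_zero hα hρ hr hx

theorem norm_stableF_sub (hr : 0 < r) (z : ℂ) : ‖stableF α ρ r z - z‖ = r * ‖z‖ ^ (1 - α) := by
  rw [stableF, add_sub_cancel_left, norm_mul, norm_mul, Complex.norm_cpow_real, mul_comm Complex.I,
    Complex.norm_exp_ofReal_mul_I, Complex.norm_real, Real.norm_of_nonneg hr.le, mul_one]

theorem differentiableOn_stableF : DifferentiableOn ℂ (stableF α ρ r) {z | 0 < z.im} :=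
  differentiableOn_id.add ((differentiableOn_const _).mul
    (differentiableOn_id.cpow (differentiableOn_const _) fun _ hz => Or.inr (ne_of_gt hz)))

/-- The principal power is continuous from above at every non-zero real. -/
theorem tendsto_cpow_vertical (s : ℂ) {x : ℝ} (hx : x ≠ 0) :
    Tendsto (fun y : ℝ => ((x : ℂ) + y * Complex.I) ^ s) (𝓝[>] 0) (𝓝 ((x : ℂ) ^ s)) := by
  have hlog : Tendsto (fun y : ℝ => Complex.log ((x : ℂ) + y * Complex.I)) (𝓝[>] 0)
      (𝓝 (Complex.log x)) := by
    rcases hx.lt_or_gt with hx | hx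
    · refine (Complex.continuousWithinAt_log_of_re_neg_of_im_zero (z := x) (by simpa using hx)
        (by simp)).tendsto.comp (tendsto_nhdsWithin_iff.2 ⟨tendsto_vertical x, ?_⟩)
      filter_upwards [self_mem_nhdsWithin] with y hy
      simpa using (le_of_lt hy : (0 : ℝ) ≤ y)
    · exact (continuousAt_clog (Or.inl (by simpa using hx))).tendsto.comp (tendsto_vertical x)
  rw [Complex.cpow_def_of_ne_zero (by simpa using hx)]
  refine ((Complex.continuous_exp.tendsto _).comp (hlog.mul_const s)).congr fun y => ?_
  have hne : (x : ℂ) + y * Complex.I ≠ 0 := fun h => hx (by simpa using congrArg Complex.re h)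
  rw [Function.comp_apply, Complex.cpow_def_of_ne_zero hne]

theorem tendsto_stableF_vertical {x : ℝ} (hx : x ≠ 0) :
    Tendsto (fun y : ℝ => stableF α ρ r (x + y * Complex.I)) (𝓝[>] 0) (𝓝 (stableF α ρ r x)) :=
  (tendsto_vertical x).add ((tendsto_cpow_vertical _ hx).const_mul _)

theorem exists_isBooleanStableLaw (hα : α ∈ Ioo (0 : ℝ) 1) (hρ : ρ ∈ Icc (0 : ℝ) 1) (hr : 0 < r) :
    ∃ β : Measure ℝ, IsBooleanStableLaw α ρ r β := by
  have hne : ∀ z : ℂ, 0 < z.im → stableF α ρ r z ≠ 0 := fun z hz h0 => by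
    have := stableF_im_ge hα hρ hr hz.le
    rw [h0, Complex.zero_im] at this
    linarith
  suffices h : ∃ β : Measure ℝ, IsProbabilityMeasure β ∧
      ∀ z : ℂ, 0 < z.im → cauchyTransform β z = (stableF α ρ r z)⁻¹ by
    obtain ⟨β, hβ, h⟩ := h
    exact ⟨β, hβ, fun z hz => by rw [fTransform, h z hz, inv_inv, stableF]⟩
  refine exists_cauchyTransform_eq (G := fun z => (stableF α ρ r z)⁻¹)
    (differentiableOn_stableF.inv hne) (fun z hz => ?_) ?_
  · rw [Complex.inv_im]
    exact div_nonpos_of_nonpos_of_nonneg (by linarith [stableF_im_ge hα hρ hr hz.le])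
      (Complex.normSq_nonneg _)
  · have hdiv : Tendsto (fun y : ℝ => (stableF α ρ r (y * Complex.I) - y * Complex.I) /
        (y * Complex.I)) atTop (𝓝 0) := by
      rw [tendsto_zero_iff_norm_tendsto_zero]
      have := (tendsto_rpow_neg_atTop hα.1).const_mul r
      rw [mul_zero] at this
      refine this.congr' ?_
      filter_upwards [eventually_gt_atTop 0] with y hy
      rw [norm_div, norm_stableF_sub hr]
      have hn : ‖(y : ℂ) * Complex.I‖ = y := by simp [abs_of_pos hy]
      rw [hn, sub_eq_add_neg, Real.rpow_add hy, Real.rpow_one]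
      field_simp
    have := (hdiv.const_add 1).inv₀ (by simp)
    simp only [add_zero, inv_one] at this
    refine this.congr' ?_
    filter_upwards [eventually_gt_atTop 0] with y hy
    have hy0 : (y : ℂ) * Complex.I ≠ 0 := by simp [hy.ne']
    rw [one_add_div hy0, add_sub_cancel, inv_div, div_eq_mul_inv]

theorem isBooleanStableLaw_booleanStableLaw (hα : α ∈ Ioo (0 : ℝ) 1) (hρ : ρ ∈ Icc (0 : ℝ) 1)
    (hr : 0 < r) : IsBooleanStableLaw α ρ r (booleanStableLaw α ρ r) := by
  have h := exists_isBooleanStableLaw hα hρ hr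
  rw [booleanStableLaw, dif_pos h]
  exact h.choose_spec

theorem cauchyTransform_of_isBooleanStableLaw {β : Measure ℝ} (hβ : IsBooleanStableLaw α ρ r β)
    {z : ℂ} (hz : 0 < z.im) : cauchyTransform β z = (stableF α ρ r z)⁻¹ := by
  rw [stableF, ← hβ.2 z hz, fTransform, inv_inv]

/-- Away from the origin, the Boolean stable law is absolutely continuous. -/
theorem restrict_of_isBooleanStableLaw (hα : α ∈ Ioo (0 : ℝ) 1) (hρ : ρ ∈ Icc (0 : ℝ) 1)
    (hr : 0 < r) {β : Measure ℝ} (hβ : IsBooleanStableLaw α ρ r β) {A : Set ℝ}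
    (hA : MeasurableSet A) (h0 : (0 : ℝ) ∉ A) :
    β.restrict A = (volume.restrict A).withDensity
      (fun x => ENNReal.ofReal (-((stableF α ρ r x)⁻¹).im / Real.pi)) := by
  have := hβ.1
  refine restrict_eq_withDensity_of_tendsto_cauchyTransform β hA fun x hx => ?_
  have hx0 : x ≠ 0 := fun h => h0 (h ▸ hx)
  refine ((tendsto_stableF_vertical hx0).inv₀ (stableF_ofReal_ne_zero hα hρ hr hx0)).congr' ?_
  filter_upwards [self_mem_nhdsWithin] with y hy
  exact (cauchyTransform_of_isBooleanStableLaw hβ (by simpa using hy)).symm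

/-- The mass of an atom at the origin is controlled by the Cauchy transform near it. -/
theorem measure_singleton_zero_le (ν : Measure ℝ) [IsFiniteMeasure ν] {y : ℝ} (hy : 0 < y) :
    ν {0} ≤ ENNReal.ofReal (y * ‖cauchyTransform ν (y * Complex.I)‖) := by
  have hz : 0 < (y * Complex.I : ℂ).im := by simpa using hy
  have h1 : ENNReal.ofReal y⁻¹ * ν {0} ≤ ENNReal.ofReal ‖cauchyTransform ν (y * Complex.I)‖ :=
    calc ENNReal.ofReal y⁻¹ * ν {0}
        = ∫⁻ x in {0}, ENNReal.ofReal (halfPlanePoisson (y * Complex.I) x) ∂ν := by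
          rw [lintegral_singleton]
          congr 2
          have := halfPlanePoisson_add_mul_I 0 y 0
          simp only [Complex.ofReal_zero, zero_add, sub_zero, ne_eq, OfNat.ofNat_ne_zero,
            not_false_eq_true, zero_pow] at this
          rw [this]
          field_simp
      _ ≤ ∫⁻ x, ENNReal.ofReal (halfPlanePoisson (y * Complex.I) x) ∂ν :=
          setLIntegral_le_lintegral _ _
      _ = ENNReal.ofReal (-(cauchyTransform ν (y * Complex.I)).im) :=
          (ofReal_neg_cauchyTransform_im ν hz).symm
      _ ≤ _ := by
          refine ENNReal.ofReal_le_ofReal ?_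
          exact (neg_le_abs _).trans (Complex.abs_im_le_norm _)
  calc ν {0} = ENNReal.ofReal y * (ENNReal.ofReal y⁻¹ * ν {0}) := by
        rw [← mul_assoc, ← ENNReal.ofReal_mul hy.le, mul_inv_cancel₀ hy.ne', ENNReal.ofReal_one,
          one_mul]
    _ ≤ ENNReal.ofReal y * ENNReal.ofReal ‖cauchyTransform ν (y * Complex.I)‖ := by gcongr
    _ = _ := (ENNReal.ofReal_mul hy.le).symm

theorem measure_zero_of_isBooleanStableLaw (hα : α ∈ Ioo (0 : ℝ) 1) (hr : 0 < r)
    {β : Measure ℝ} (hβ : IsBooleanStableLaw α ρ r β) : β {0} = 0 := by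
  have := hβ.1
  have hinf : Tendsto (fun y : ℝ => r * y ^ (-α) - 1) (𝓝[>] 0) atTop :=
    tendsto_atTop_add_const_right _ _
      ((tendsto_rpow_neg_nhdsGT_zero (neg_lt_zero.2 hα.1)).const_mul_atTop hr)
  have hlim := ENNReal.tendsto_ofReal (tendsto_inv_atTop_zero.comp hinf)
  rw [ENNReal.ofReal_zero] at hlim
  refine le_antisymm (ge_of_tendsto hlim ?_) bot_le
  filter_upwards [self_mem_nhdsWithin, hinf.eventually_gt_atTop 0] with y hy hpos
  have hy' : (0 : ℝ) < y := hy
  refine (measure_singleton_zero_le β hy').trans (ENNReal.ofReal_le_ofReal ?_)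
  have hn : ‖(y : ℂ) * Complex.I‖ = y := by simp [abs_of_pos hy']
  have hbound : y * (r * y ^ (-α) - 1) ≤ ‖stableF α ρ r (y * Complex.I)‖ := by
    have h1 := norm_sub_norm_le (stableF α ρ r (y * Complex.I) - y * Complex.I)
      (-(y * Complex.I))
    rw [norm_stableF_sub hr, norm_neg, hn, sub_neg_eq_add, sub_add_cancel] at h1
    rw [sub_eq_add_neg 1 α, Real.rpow_add hy', Real.rpow_one] at h1
    linarith
  rw [cauchyTransform_of_isBooleanStableLaw hβ (by simpa using hy'), norm_inv,
    Function.comp_apply, ← div_eq_mul_inv, inv_eq_one_div,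
    div_le_div_iff₀ ((mul_pos hy' hpos).trans_le hbound) hpos]
  linarith

end

/-- The density of the log Boolean stable law at `y > 0`, `y ≠ 1`. -/
noncomputable def logStableDensity (α ρ r y : ℝ) : ℝ :=
  (Real.pi * y)⁻¹ * -((stableF α ρ r (Real.log y))⁻¹).im

theorem neg_inv_im (z : ℂ) : -(z⁻¹).im = z.im / (z.re ^ 2 + z.im ^ 2) := by
  rw [Complex.inv_im, Complex.normSq_apply, neg_div, neg_neg]
  ring

/-- The identity holds also where the denominators vanish, both sides then being `0`. -/
theorem neg_inv_stableF_im_of_pos (α ρ r : ℝ) {x : ℝ} (hx : 0 < x) :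
    -((stableF α ρ r x)⁻¹).im = r * Real.sin (α * ρ * Real.pi) * (x ^ (α - 1) /
      (x ^ (2 * α) + 2 * r * Real.cos (α * ρ * Real.pi) * x ^ α + r ^ 2)) := by
  obtain ⟨h1, h2⟩ := stableF_ofReal_pos α ρ r hx
  rw [neg_inv_im, h1, h2]
  set c := Real.cos (α * ρ * Real.pi)
  set s := Real.sin (α * ρ * Real.pi)
  have hcs : s ^ 2 = 1 - c ^ 2 := by
    rw [eq_sub_iff_add_eq]
    exact Real.sin_sq_add_cos_sq _
  -- everything is expressed through `b = x ^ (1 - α)`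
  have hb : 0 < x ^ (1 - α) := Real.rpow_pos_of_pos hx _
  have e1 : x ^ (α - 1) = (x ^ (1 - α))⁻¹ := by
    rw [← Real.rpow_neg hx.le]; congr 1; ring
  have e2 : x ^ α = x / x ^ (1 - α) := by
    rw [eq_div_iff hb.ne', ← Real.rpow_add hx]; simp
  have e3 : x ^ (2 * α) = (x / x ^ (1 - α)) ^ 2 := by
    rw [← e2, ← Real.rpow_natCast, ← Real.rpow_mul hx.le]; congr 1; push_cast; ring
  rw [e1, e2, e3]
  set b := x ^ (1 - α)
  have e4 : (x + r * b * c) ^ 2 + (r * b * s) ^ 2 =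
      b ^ 2 * ((x / b) ^ 2 + 2 * r * c * (x / b) + r ^ 2) := by
    rw [mul_pow (r * b) s, hcs]
    field_simp
    ring
  rw [e4]
  by_cases hD : (x / b) ^ 2 + 2 * r * c * (x / b) + r ^ 2 = 0
  · rw [hD]
    simp
  · rw [div_eq_iff (mul_ne_zero (pow_ne_zero 2 hb.ne') hD)]
    generalize (x / b) ^ 2 + 2 * r * c * (x / b) + r ^ 2 = D at hD
    field_simp

theorem logStableDensity_of_one_lt (α ρ r : ℝ) {y : ℝ} (hy : 1 < y) :
    logStableDensity α ρ r y = r * Real.sin (α * ρ * Real.pi) / (Real.pi * y) *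
      ((Real.log y) ^ (α - 1) / ((Real.log y) ^ (2 * α) +
        2 * r * Real.cos (α * ρ * Real.pi) * (Real.log y) ^ α + r ^ 2)) := by
  rw [logStableDensity, neg_inv_stableF_im_of_pos α ρ r (Real.log_pos hy), div_eq_mul_inv]
  ring

theorem logStableDensity_of_lt_one (α ρ r : ℝ) {y : ℝ} (hy : y ∈ Ioo (0 : ℝ) 1) :
    logStableDensity α ρ r y = r * Real.sin (α * (1 - ρ) * Real.pi) / (Real.pi * y) *
      ((-Real.log y) ^ (α - 1) / ((-Real.log y) ^ (2 * α) +
        2 * r * Real.cos (α * (1 - ρ) * Real.pi) * (-Real.log y) ^ α + r ^ 2)) := by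
  have hl := Real.log_neg hy.1 hy.2
  obtain ⟨h1, h2⟩ := stableF_ofReal_neg α ρ r hl
  rw [logStableDensity, neg_inv_im, h1, h2, neg_sq, ← neg_inv_im,
    neg_inv_stableF_im_of_pos α (1 - ρ) r (neg_pos.2 hl), div_eq_mul_inv]
  ring

/-! ### Rescaled boundary values near `1` -/

/-- First-order expansion along a filter: if `d → 0` and `c d → v`, then
`c (f (a + d) - f a) → v f'(a)`. -/
theorem tendsto_mul_sub_of_hasDerivAt {𝕜 : Type*} [NontriviallyNormedField 𝕜] {f : 𝕜 → 𝕜}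
    {f' a : 𝕜} (hf : HasDerivAt f f' a) {ι : Type*} {l : Filter ι} {c d : ι → 𝕜} {v : 𝕜}
    (hd : Tendsto d l (𝓝 0)) (hcd : Tendsto (fun i => c i * d i) l (𝓝 v)) :
    Tendsto (fun i => c i * (f (a + d i) - f a)) l (𝓝 (v * f')) := by
  have := (hf.hasFDerivAt.hasFDerivWithinAt (s := univ)).lim hd
    (Eventually.of_forall fun _ => mem_univ _) hcd
  simpa using this

theorem ofReal_mul_cpow {q : ℝ} (hq : 0 < q) {z : ℂ} (hz : z ≠ 0) (s : ℝ) :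
    ((q : ℂ) * z) ^ (s : ℂ) = ((q ^ s : ℝ) : ℂ) * z ^ (s : ℂ) := by
  have hq' : (q : ℂ) ≠ 0 := by simpa using hq.ne'
  rw [Complex.cpow_def_of_ne_zero (mul_ne_zero hq' hz), Complex.log_ofReal_mul hq hz, add_mul,
    Complex.exp_add, Complex.cpow_def_of_ne_zero hz, Complex.ofReal_cpow hq.le,
    Complex.cpow_def_of_ne_zero hq', Complex.ofReal_log hq.le]

section Asymptotics

variable {FB : ℝ → ℂ} {α ρ r : ℝ} {ι : Type*} {l : Filter ι} {q u : ι → ℝ} {u₀ : ℝ}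

theorem tendsto_exp_mul_sub_one_div (hq : Tendsto q l (𝓝[>] 0)) (hu : Tendsto u l (𝓝 u₀)) :
    Tendsto (fun i => (Real.exp (q i * u i) - 1) / q i) l (𝓝 u₀) := by
  have hq0 : Tendsto q l (𝓝 0) := hq.mono_right nhdsWithin_le_nhds
  have hd : Tendsto (fun i => q i * u i) l (𝓝 0) := by simpa using hq0.mul hu
  have hcd : Tendsto (fun i => (q i)⁻¹ * (q i * u i)) l (𝓝 u₀) := by
    refine hu.congr' ?_
    filter_upwards [hq.eventually self_mem_nhdsWithin] with i hi
    rw [inv_mul_cancel_left₀ (ne_of_gt hi)]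
  have := tendsto_mul_sub_of_hasDerivAt (Real.hasDerivAt_exp 0) hd hcd
  simp only [zero_add, Real.exp_zero, mul_one] at this
  exact this.congr fun i => by rw [div_eq_inv_mul]

theorem tendsto_exp_mul_nhdsNE (hq : Tendsto q l (𝓝[>] 0)) (hu : Tendsto u l (𝓝 u₀))
    (hu₀ : u₀ ≠ 0) : Tendsto (fun i => Real.exp (q i * u i)) l (𝓝[≠] 1) := by
  have hq0 : Tendsto q l (𝓝 0) := hq.mono_right nhdsWithin_le_nhds
  have hd : Tendsto (fun i => q i * u i) l (𝓝 0) := by simpa using hq0.mul hu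
  refine tendsto_nhdsWithin_iff.2
    ⟨by simpa [Function.comp_def] using (Real.continuous_exp.tendsto 0).comp hd, ?_⟩
  filter_upwards [hq.eventually self_mem_nhdsWithin, hu.eventually_ne hu₀] with i hi hi'
  have : q i * u i ≠ 0 := mul_ne_zero (ne_of_gt hi) hi'
  simpa using this

/-- The hypothesis on the boundary values, rescaled: `F(e^{qu}) / q^{1-α}` converges as `q ↓ 0`. -/
theorem tendsto_boundary_div
    (hF : (fun x : ℝ => FB x -
        (r : ℂ) * Complex.exp (Complex.I * (α * ρ * Real.pi : ℝ)) *
          ((x - 1 : ℝ) : ℂ) ^ ((1 - α : ℝ) : ℂ))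
      =o[𝓝[≠] (1 : ℝ)] (fun x : ℝ => |x - 1| ^ (1 - α)))
    (hq : Tendsto q l (𝓝[>] 0)) (hu : Tendsto u l (𝓝 u₀)) (hu₀ : u₀ ≠ 0) :
    Tendsto (fun i => FB (Real.exp (q i * u i)) / ((q i ^ (1 - α) : ℝ) : ℂ)) l
      (𝓝 (stableF α ρ r u₀ - u₀)) := by
  have hx := tendsto_exp_mul_nhdsNE hq hu hu₀
  have hv := tendsto_exp_mul_sub_one_div hq hu
  set v : ι → ℝ := fun i => (Real.exp (q i * u i) - 1) / q i with hvdef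
  have hqpos : ∀ᶠ i in l, 0 < q i := hq.eventually self_mem_nhdsWithin
  -- the error term is `o(|x - 1|^{1-α})`, and `|x - 1|` is of order `q`
  have herr : Tendsto (fun i => (FB (Real.exp (q i * u i)) -
      (r : ℂ) * Complex.exp (Complex.I * (α * ρ * Real.pi : ℝ)) *
        ((Real.exp (q i * u i) - 1 : ℝ) : ℂ) ^ ((1 - α : ℝ) : ℂ)) / ((q i ^ (1 - α) : ℝ) : ℂ)) l
      (𝓝 0) := by
    have h1 := hF.comp_tendsto hx
    have hbig : (fun i => |Real.exp (q i * u i) - 1| ^ (1 - α)) =O[l]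
        fun i => q i ^ (1 - α) := by
      have hlim : Tendsto (fun i => |v i| ^ (1 - α)) l (𝓝 (|u₀| ^ (1 - α))) :=
        hv.abs.rpow_const (Or.inl (abs_ne_zero.2 hu₀))
      refine isBigO_of_div_tendsto_nhds ?_ _ (hlim.congr' ?_)
      · filter_upwards [hqpos] with i hi h
        exact absurd h (Real.rpow_pos_of_pos hi _).ne'
      · filter_upwards [hqpos] with i hi
        rw [hvdef, Pi.div_apply, abs_div, abs_of_pos hi, Real.div_rpow (abs_nonneg _) hi.le]
    rw [tendsto_zero_iff_norm_tendsto_zero]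
    refine (h1.trans_isBigO hbig).norm_left.tendsto_div_nhds_zero.congr' ?_
    filter_upwards [hqpos] with i hi
    rw [norm_div, Complex.norm_real, Real.norm_of_nonneg (Real.rpow_nonneg hi.le _)]
    rfl
  have hmain : Tendsto (fun i => (r : ℂ) * Complex.exp (Complex.I * (α * ρ * Real.pi : ℝ)) *
      ((v i : ℝ) : ℂ) ^ ((1 - α : ℝ) : ℂ)) l (𝓝 (stableF α ρ r u₀ - u₀)) := by
    rw [stableF, add_sub_cancel_left]
    exact ((Complex.continuousAt_ofReal_cpow_const u₀ _ (Or.inr hu₀)).tendsto.comp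
      hv).const_mul _
  have := herr.add hmain
  rw [zero_add] at this
  refine this.congr' ?_
  filter_upwards [hqpos, hv.eventually_ne hu₀] with i hi hvi
  have e : ((Real.exp (q i * u i) - 1 : ℝ) : ℂ) = (q i : ℂ) * (v i : ℂ) := by
    rw [← Complex.ofReal_mul, hvdef]
    congr 1
    field_simp
  have hvi' : (v i : ℂ) ≠ 0 := by simpa using hvi
  have hqs : ((q i ^ (1 - α) : ℝ) : ℂ) ≠ 0 := by
    rw [Complex.ofReal_ne_zero]
    exact (Real.rpow_pos_of_pos hi _).ne'
  rw [e, ofReal_mul_cpow hi hvi', sub_div, ← mul_assoc, mul_right_comm, mul_div_cancel_right₀]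
  · ring
  · exact hqs

/-- The boundary value at `x` of the reciprocal Cauchy transform of the `t`-th multiplicative
Boolean power, where `FB` are the boundary values for the original measure. -/
noncomputable def powerBoundary (FB : ℝ → ℂ) (t x : ℝ) : ℂ :=
  (x : ℂ) - ((x : ℂ) - FB x) ^ (t : ℂ)

/-- The boundary values of `K = x - F` satisfy `K - 1 ~ -F` at scale `q^{1-α}`, since
`x - 1 = O(q)` is negligible. -/
theorem tendsto_selfEnergy_boundary (hα : α ∈ Ioo (0 : ℝ) 1)
    (hF : (fun x : ℝ => FB x -
        (r : ℂ) * Complex.exp (Complex.I * (α * ρ * Real.pi : ℝ)) *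
          ((x - 1 : ℝ) : ℂ) ^ ((1 - α : ℝ) : ℂ))
      =o[𝓝[≠] (1 : ℝ)] (fun x : ℝ => |x - 1| ^ (1 - α)))
    (hq : Tendsto q l (𝓝[>] 0)) (hu : Tendsto u l (𝓝 u₀)) (hu₀ : u₀ ≠ 0) :
    Tendsto (fun i => ((q i ^ (1 - α) : ℝ) : ℂ)⁻¹ *
        ((Real.exp (q i * u i) : ℂ) - FB (Real.exp (q i * u i)) - 1)) l
      (𝓝 (-(stableF α ρ r u₀ - u₀))) ∧
    Tendsto (fun i => (Real.exp (q i * u i) : ℂ) - FB (Real.exp (q i * u i)) - 1) l (𝓝 0) := by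
  have hq0 : Tendsto q l (𝓝 0) := hq.mono_right nhdsWithin_le_nhds
  have hqpos : ∀ᶠ i in l, 0 < q i := hq.eventually self_mem_nhdsWithin
  have hb := tendsto_boundary_div hF hq hu hu₀
  have hv := tendsto_exp_mul_sub_one_div hq hu
  have hqα : ∀ s : ℝ, 0 < s → Tendsto (fun i => q i ^ s) l (𝓝 0) := fun s hs => by
    simpa [Real.zero_rpow hs.ne'] using hq0.rpow_const (Or.inr hs.le) (p := s)
  have h1 : Tendsto (fun i => (((q i ^ α * ((Real.exp (q i * u i) - 1) / q i) : ℝ)) : ℂ)) l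
      (𝓝 0) := by
    have := (hqα α hα.1).mul hv
    rw [zero_mul] at this
    exact_mod_cast (Complex.continuous_ofReal.tendsto _).comp this
  have hmain : Tendsto (fun i => ((q i ^ (1 - α) : ℝ) : ℂ)⁻¹ *
        ((Real.exp (q i * u i) : ℂ) - FB (Real.exp (q i * u i)) - 1)) l
      (𝓝 (-(stableF α ρ r u₀ - u₀))) := by
    have := h1.sub hb
    rw [zero_sub] at this
    refine this.congr' ?_
    filter_upwards [hqpos] with i hi
    have e : q i ^ α * ((Real.exp (q i * u i) - 1) / q i) =
        (q i ^ (1 - α))⁻¹ * (Real.exp (q i * u i) - 1) := by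
      rw [← Real.rpow_neg hi.le, neg_sub, Real.rpow_sub hi, Real.rpow_one]
      ring
    rw [e]
    push_cast
    ring
  refine ⟨hmain, ?_⟩
  have h2 := ((Complex.continuous_ofReal.tendsto _).comp
    (hqα (1 - α) (by linarith [hα.2]))).mul hmain
  rw [Complex.ofReal_zero, zero_mul] at h2
  refine h2.congr' ?_
  filter_upwards [hqpos] with i hi
  have hqs : ((q i ^ (1 - α) : ℝ) : ℂ) ≠ 0 := by
    rw [Complex.ofReal_ne_zero]
    exact (Real.rpow_pos_of_pos hi _).ne'
  rw [Function.comp_apply, mul_inv_cancel_left₀ hqs]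

/-- Near `1`, at the scale `q = t^{1/α}`, the boundary values of the `t`-th power converge to those
of the Boolean stable law. -/
theorem tendsto_powerBoundary_div (hα : α ∈ Ioo (0 : ℝ) 1)
    (hF : (fun x : ℝ => FB x -
        (r : ℂ) * Complex.exp (Complex.I * (α * ρ * Real.pi : ℝ)) *
          ((x - 1 : ℝ) : ℂ) ^ ((1 - α : ℝ) : ℂ))
      =o[𝓝[≠] (1 : ℝ)] (fun x : ℝ => |x - 1| ^ (1 - α)))
    (hq : Tendsto q l (𝓝[>] 0)) (hu : Tendsto u l (𝓝 u₀)) (hu₀ : u₀ ≠ 0) :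
    Tendsto (fun i => powerBoundary FB (q i ^ α) (Real.exp (q i * u i)) / (q i : ℂ)) l
      (𝓝 (stableF α ρ r u₀)) := by
  obtain ⟨hK, hK0⟩ := tendsto_selfEnergy_boundary hα hF hq hu hu₀
  have hqpos : ∀ᶠ i in l, 0 < q i := hq.eventually self_mem_nhdsWithin
  have hq0 : Tendsto q l (𝓝 0) := hq.mono_right nhdsWithin_le_nhds
  have hv := tendsto_exp_mul_sub_one_div hq hu
  set D : ι → ℂ := fun i => (Real.exp (q i * u i) : ℂ) - FB (Real.exp (q i * u i)) - 1 with hD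
  have hlog := tendsto_mul_sub_of_hasDerivAt
    (Complex.hasDerivAt_log (Or.inl (by simp) : (1 : ℂ) ∈ Complex.slitPlane)) hK0 hK
  simp only [Complex.log_one, sub_zero, inv_one, mul_one] at hlog
  -- `t log K`, with `t = q ^ α`, has scale `q`
  have hexpo : Tendsto (fun i => (q i : ℂ)⁻¹ * (((q i ^ α : ℝ) : ℂ) * Complex.log (1 + D i))) l
      (𝓝 (-(stableF α ρ r u₀ - u₀))) := by
    refine hlog.congr' ?_
    filter_upwards [hqpos] with i hi
    rw [← mul_assoc]
    congr 1
    rw [← Complex.ofReal_inv, ← Complex.ofReal_inv, ← Complex.ofReal_mul]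
    congr 1
    rw [← Real.rpow_neg hi.le, neg_sub, Real.rpow_sub hi, Real.rpow_one]
    ring
  have hexpo0 : Tendsto (fun i => ((q i ^ α : ℝ) : ℂ) * Complex.log (1 + D i)) l (𝓝 0) := by
    have := ((Complex.continuous_ofReal.tendsto _).comp hq0).mul hexpo
    rw [Complex.ofReal_zero, zero_mul] at this
    refine this.congr' ?_
    filter_upwards [hqpos] with i hi
    have : (q i : ℂ) ≠ 0 := by simpa using hi.ne'
    rw [Function.comp_apply, mul_inv_cancel_left₀ this]
  have hexp := tendsto_mul_sub_of_hasDerivAt (Complex.hasDerivAt_exp 0) hexpo0 hexpo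
  simp only [Complex.exp_zero, zero_add, mul_one] at hexp
  have hv' : Tendsto (fun i => (((Real.exp (q i * u i) - 1) / q i : ℝ) : ℂ)) l (𝓝 (u₀ : ℂ)) :=
    (Complex.continuous_ofReal.tendsto _).comp hv
  have := hv'.sub hexp
  rw [sub_neg_eq_add, add_sub_cancel] at this
  refine this.congr' ?_
  have hne : ∀ᶠ i in l, 1 + D i ≠ 0 := by
    have : Tendsto (fun i => 1 + D i) l (𝓝 (1 + 0)) := hK0.const_add 1
    exact this.eventually_ne (by simp)
  filter_upwards [hqpos, hne] with i hi hnei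
  have e : (Real.exp (q i * u i) : ℂ) - FB (Real.exp (q i * u i)) = 1 + D i := by
    rw [hD]; ring
  rw [powerBoundary, e, Complex.cpow_def_of_ne_zero hnei, mul_comm (Complex.log _)]
  push_cast
  ring

end Asymptotics

/-! ### Push-forward densities and weak convergence -/

/-- Change of variables for the density of a push-forward by `φ`, given a local inverse `ψ`. -/
theorem map_restrict_eq_withDensity {ν : Measure ℝ} {φ ψ ψ' d : ℝ → ℝ} {K : Set ℝ}
    (hφ : Measurable φ) (hK : MeasurableSet K) (hψ : ∀ y ∈ K, HasDerivAt ψ (ψ' y) y)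
    (hφψ : ∀ y ∈ K, φ (ψ y) = y) (hψφ : ∀ᵐ x ∂ν, φ x ∈ K → ψ (φ x) = x)
    (hd : ν.restrict (ψ '' K) =
      (volume.restrict (ψ '' K)).withDensity fun x => ENNReal.ofReal (d x)) :
    (ν.map φ).restrict K =
      (volume.restrict K).withDensity fun y => ENNReal.ofReal (|ψ' y| * d (ψ y)) := by
  have hcont : ContinuousOn ψ K := fun y hy => (hψ y hy).continuousAt.continuousWithinAt
  have hinj : InjOn ψ K := fun a ha b hb hab => by rw [← hφψ a ha, ← hφψ b hb, hab]
  ext s hs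
  have hsK : MeasurableSet (s ∩ K) := hs.inter hK
  have himg : MeasurableSet (ψ '' (s ∩ K)) :=
    hsK.image_of_continuousOn_injOn (hcont.mono inter_subset_right) (hinj.mono inter_subset_right)
  have hae : φ ⁻¹' (s ∩ K) =ᵐ[ν] ψ '' (s ∩ K) := by
    filter_upwards [hψφ] with x hx
    refine propext ⟨fun h => ⟨φ x, h, hx h.2⟩, ?_⟩
    rintro ⟨y, hy, rfl⟩
    change φ (ψ y) ∈ s ∩ K
    rwa [hφψ y hy.2]
  have hsub : ψ '' (s ∩ K) ⊆ ψ '' K := image_mono inter_subset_right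
  rw [Measure.restrict_apply hs, Measure.map_apply hφ hsK, measure_congr hae,
    ← inter_eq_self_of_subset_left hsub, ← Measure.restrict_apply himg, hd,
    withDensity_apply _ himg, withDensity_apply _ hs, Measure.restrict_restrict himg,
    Measure.restrict_restrict hs, inter_eq_self_of_subset_left hsub,
    lintegral_image_eq_lintegral_abs_deriv_mul hsK
      (fun y hy => (hψ y hy.2).hasDerivWithinAt) (hinj.mono inter_subset_right)]
  exact lintegral_congr fun y => (ENNReal.ofReal_mul (abs_nonneg _)).symm

/-- Densities that converge locally uniformly on an open set of full mass give weak convergence: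
the mass of each open set is approximated from inside by compact subsets of that set. -/
theorem tendsto_integral_of_densities {ν : ℝ → Measure ℝ} {p : ℝ → ℝ} {U : Set ℝ}
    {Q : Measure ℝ} [IsProbabilityMeasure Q] (hU : IsOpen U) (hQU : Q Uᶜ = 0)
    (hν : ∀ᶠ t in 𝓝[>] (0 : ℝ), IsProbabilityMeasure (ν t))
    (hd : DensitiesTendstoUniformlyOnCompacts ν p U) (hp : ContinuousOn p U)
    (hQ : ∀ K, IsCompact K → K ⊆ U →
      Q.restrict K = (volume.restrict K).withDensity fun x => ENNReal.ofReal (p x))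
    (g : BoundedContinuousFunction ℝ ℝ) :
    Tendsto (fun t => ∫ x, g x ∂(ν t)) (𝓝[>] 0) (𝓝 (∫ x, g x ∂Q)) := by
  classical
  obtain ⟨f, hfm, -, hf⟩ := hd
  have hcompact : ∀ K, IsCompact K → K ⊆ U → Tendsto (fun t => ν t K) (𝓝[>] 0) (𝓝 (Q K)) := by
    intro K hK hKU
    obtain ⟨hac, hunif⟩ := hf K hK hKU
    obtain ⟨C, hC⟩ := (hK.image_of_continuousOn (hp.mono hKU)).bddAbove
    have hlim : Tendsto (fun t => ∫⁻ x in K, ENNReal.ofReal (f t x)) (𝓝[>] 0)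
        (𝓝 (∫⁻ x in K, ENNReal.ofReal (p x))) := by
      refine tendsto_lintegral_filter_of_dominated_convergence
        (fun _ => ENNReal.ofReal (C + 1))
        (Eventually.of_forall fun t => (hfm t).ennreal_ofReal) ?_ ?_ ?_
      · filter_upwards [Metric.tendstoUniformlyOn_iff.1 hunif 1 one_pos] with t ht
        filter_upwards [ae_restrict_mem hK.measurableSet] with x hx
        refine ENNReal.ofReal_le_ofReal ?_
        have h1 := ht x hx
        rw [dist_comm, Real.dist_eq] at h1
        have h2 := hC (mem_image_of_mem p hx)
        linarith [(abs_lt.1 h1).2]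
      · rw [setLIntegral_const]
        exact ENNReal.mul_ne_top ENNReal.ofReal_ne_top hK.measure_ne_top
      · filter_upwards [ae_restrict_mem hK.measurableSet] with x hx
        exact ENNReal.tendsto_ofReal (hunif.tendsto_at hx)
    have hval : ∀ {ρ : Measure ℝ} {h : ℝ → ℝ},
        ρ.restrict K = (volume.restrict K).withDensity (fun x => ENNReal.ofReal (h x)) →
        ρ K = ∫⁻ x in K, ENNReal.ofReal (h x) := fun {ρ h} e => by
      rw [← Measure.restrict_apply_self, e, withDensity_apply _ hK.measurableSet,
        Measure.restrict_restrict hK.measurableSet, inter_self]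
    rw [hval (hQ K hK hKU)]
    refine hlim.congr' ?_
    filter_upwards [hac] with t ht
    exact (hval ht).symm
  have hQp : IsProbabilityMeasure Q := inferInstance
  let P : ℝ → ProbabilityMeasure ℝ := fun t =>
    if h : IsProbabilityMeasure (ν t) then ⟨ν t, h⟩ else ⟨Q, hQp⟩
  have hP : ∀ᶠ t in 𝓝[>] (0 : ℝ), (P t : Measure ℝ) = ν t := by
    filter_upwards [hν] with t ht
    have : P t = ⟨ν t, ht⟩ := dif_pos ht
    rw [this]
    rfl
  have hweak : Tendsto P (𝓝[>] 0) (𝓝 ⟨Q, hQp⟩) := by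
    refine tendsto_of_forall_isOpen_le_liminf' fun G hG => ?_
    change Q G ≤ _
    have hGU : Q G = Q (G ∩ U) := by
      refine (measure_inter_conull ?_).symm
      exact hQU
    rw [hGU, (hG.inter hU).measure_eq_iSup_isCompact]
    refine iSup_le fun K => iSup_le fun hKG => iSup_le fun hK => ?_
    have ht := hcompact K hK (hKG.trans inter_subset_right)
    rw [← ht.liminf_eq]
    refine liminf_le_liminf ?_
    filter_upwards [hP] with t ht
    rw [ht]
    exact measure_mono (hKG.trans inter_subset_left)
  refine (ProbabilityMeasure.tendsto_iff_forall_integral_tendsto.1 hweak g).congr' ?_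
  filter_upwards [hP] with t ht
  rw [ht]

/-! ### The log Boolean stable law -/

section

variable {α ρ r : ℝ}

theorem logBooleanStableLaw_restrict (hα : α ∈ Ioo (0 : ℝ) 1) (hρ : ρ ∈ Icc (0 : ℝ) 1)
    (hr : 0 < r) {K : Set ℝ} (hK : MeasurableSet K) (hKU : K ⊆ Ioi 0 \ {1}) :
    (logBooleanStableLaw α ρ r).restrict K =
      (volume.restrict K).withDensity fun x => ENNReal.ofReal (logStableDensity α ρ r x) := by
  have hβ := isBooleanStableLaw_booleanStableLaw hα hρ hr
  have hne : ∀ y ∈ K, y ≠ 0 := fun y hy => ne_of_gt (hKU hy).1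
  have hcont : ContinuousOn Real.log K :=
    Real.continuousOn_log.mono fun y hy => hne y hy
  have himg : MeasurableSet (Real.log '' K) :=
    hK.image_of_continuousOn_injOn hcont (Real.log_injOn_pos.mono fun y hy => (hKU hy).1)
  have h0 : (0 : ℝ) ∉ Real.log '' K := by
    rintro ⟨y, hy, h⟩
    exact (hKU hy).2 (Real.eq_one_of_pos_of_log_eq_zero (hKU hy).1 h)
  rw [logBooleanStableLaw, map_restrict_eq_withDensity Real.measurable_exp hK
    (fun y hy => Real.hasDerivAt_log (hne y hy)) (fun y hy => Real.exp_log (hKU hy).1)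
    (Eventually.of_forall fun x _ => Real.log_exp x)
    (restrict_of_isBooleanStableLaw hα hρ hr hβ himg h0)]
  refine withDensity_congr_ae ?_
  filter_upwards [ae_restrict_mem hK] with y hy
  rw [logStableDensity, abs_of_pos (inv_pos.2 (hKU hy).1), mul_inv, div_eq_mul_inv]
  congr 1
  ring

theorem isProbabilityMeasure_logBooleanStableLaw (hα : α ∈ Ioo (0 : ℝ) 1)
    (hρ : ρ ∈ Icc (0 : ℝ) 1) (hr : 0 < r) : IsProbabilityMeasure (logBooleanStableLaw α ρ r) := by
  have := (isBooleanStableLaw_booleanStableLaw hα hρ hr).1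
  exact Measure.isProbabilityMeasure_map Real.measurable_exp.aemeasurable

theorem logBooleanStableLaw_compl (hα : α ∈ Ioo (0 : ℝ) 1) (hρ : ρ ∈ Icc (0 : ℝ) 1) (hr : 0 < r) :
    logBooleanStableLaw α ρ r (Ioi 0 \ {1})ᶜ = 0 := by
  have hβ := isBooleanStableLaw_booleanStableLaw hα hρ hr
  rw [logBooleanStableLaw, Measure.map_apply Real.measurable_exp
    (measurableSet_Ioi.diff (measurableSet_singleton 1)).compl]
  refine measure_mono_null (fun x hx => ?_) (measure_zero_of_isBooleanStableLaw hα hr hβ)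
  by_contra hx0
  exact hx ⟨Real.exp_pos x, by simpa using hx0⟩

theorem continuousOn_logStableDensity (hα : α ∈ Ioo (0 : ℝ) 1) (hρ : ρ ∈ Icc (0 : ℝ) 1)
    (hr : 0 < r) : ContinuousOn (logStableDensity α ρ r) (Ioi 0 \ {1}) := by
  intro y hy
  have hy0 : (0 : ℝ) < y := hy.1
  have hl : Real.log y ≠ 0 := fun h => hy.2 (Real.eq_one_of_pos_of_log_eq_zero hy0 h)
  have hF : ContinuousAt (fun x : ℝ => stableF α ρ r x) (Real.log y) :=
    Complex.continuous_ofReal.continuousAt.add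
      ((Complex.continuousAt_ofReal_cpow_const _ _ (Or.inr hl)).const_mul _)
  have hFl : ContinuousAt (fun y : ℝ => stableF α ρ r (Real.log y)) y :=
    ContinuousAt.comp (g := fun x : ℝ => stableF α ρ r x) hF (Real.continuousAt_log hy0.ne')
  refine ContinuousAt.continuousWithinAt (ContinuousAt.mul ?_ ?_)
  · exact (continuousAt_const.mul continuousAt_id).inv₀
      (mul_ne_zero Real.pi_ne_zero hy0.ne')
  · exact (Complex.continuous_im.continuousAt.comp
      (hFl.inv₀ (stableF_ofReal_ne_zero hα hρ hr hl))).neg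

theorem logStableDensity_nonneg (hα : α ∈ Ioo (0 : ℝ) 1) (hρ : ρ ∈ Icc (0 : ℝ) 1)
    (hr : 0 < r) {y : ℝ} (hy : 0 < y) : 0 ≤ logStableDensity α ρ r y := by
  refine mul_nonneg (by have := Real.pi_pos; positivity) ?_
  rw [neg_inv_im]
  have := stableF_im_ge hα hρ hr (z := (Real.log y : ℂ)) (by simp)
  rw [Complex.ofReal_im] at this
  positivity

end

/-! ### Boundary values of the powers -/

theorem BoundaryValueAssumption.exists_tendsto {μ : Measure ℝ} (h : BoundaryValueAssumption μ) :
    ∃ I : Set ℝ, IsOpen I ∧ (1 : ℝ) ∈ I ∧ ∀ x ∈ I,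
      Tendsto (fun y : ℝ => fTransform μ ((x : ℂ) + y * Complex.I)) (𝓝[>] 0)
        (𝓝 (fBoundary μ x)) := by
  obtain ⟨⟨I, hI, -, -, h1, hlim⟩, -⟩ := h
  refine ⟨I, hI, h1, fun x hx => ?_⟩
  obtain ⟨w, -, hw⟩ := hlim x hx
  rwa [fBoundary, hw.limUnder_eq]

theorem measurable_indicator_fBoundary {μ : Measure ℝ} [IsProbabilityMeasure μ] {I : Set ℝ}
    (hI : IsOpen I)
    (hlim : ∀ x ∈ I, Tendsto (fun y : ℝ => fTransform μ ((x : ℂ) + y * Complex.I)) (𝓝[>] 0)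
      (𝓝 (fBoundary μ x))) : Measurable (I.indicator (fBoundary μ)) := by
  have hseq : Tendsto (fun n : ℕ => 1 / ((n : ℝ) + 1)) atTop (𝓝[>] 0) :=
    tendsto_nhdsWithin_iff.2 ⟨tendsto_one_div_add_atTop_nhds_zero_nat,
      Eventually.of_forall fun n => by
        have : (0 : ℝ) < (n : ℝ) + 1 := by positivity
        exact one_div_pos.2 this⟩
  refine measurable_of_tendsto_metrizable (f := fun (n : ℕ) => I.indicator fun x : ℝ =>
    fTransform μ ((x : ℂ) + ((1 / ((n : ℝ) + 1) : ℝ) : ℂ) * Complex.I)) (fun n => ?_) ?_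
  · refine Measurable.indicator ?_ hI.measurableSet
    refine Continuous.measurable ?_
    refine (differentiableOn_fTransform_upper μ).continuousOn.comp_continuous (by fun_prop)
      fun x => ?_
    have : (0 : ℝ) < (n : ℝ) + 1 := by positivity
    change 0 < ((x : ℂ) + ((1 / ((n : ℝ) + 1) : ℝ) : ℂ) * Complex.I).im
    have him : ∀ a b : ℝ, ((a : ℂ) + b * Complex.I).im = b := by simp
    rw [him]
    exact one_div_pos.2 this
  · rw [tendsto_pi_nhds]
    intro x
    by_cases hx : x ∈ I
    · simp only [indicator_of_mem hx]
      exact (hlim x hx).comp hseq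
    · simp only [indicator_of_notMem hx]
      exact tendsto_const_nhds

/-- Continuity at `1` and the asymptotic expansion force `F_μ(1 + i0) = 0`. -/
theorem fBoundary_one_eq_zero {μ : Measure ℝ} (hc : ContinuousAt (fBoundary μ) 1)
    {α ρ r : ℝ} (hα : α < 1)
    (hF : (fun x : ℝ => fBoundary μ x -
        (r : ℂ) * Complex.exp (Complex.I * (α * ρ * Real.pi : ℝ)) *
          ((x - 1 : ℝ) : ℂ) ^ ((1 - α : ℝ) : ℂ))
      =o[𝓝[≠] (1 : ℝ)] (fun x : ℝ => |x - 1| ^ (1 - α))) : fBoundary μ 1 = 0 := by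
  have hα' : 0 < 1 - α := by linarith
  have h1 : Tendsto (fun x : ℝ => x - 1) (𝓝[≠] 1) (𝓝 0) :=
    ((continuous_id.sub continuous_const).tendsto' 1 0 (by simp)).mono_left nhdsWithin_le_nhds
  have hpow : Tendsto (fun x : ℝ => |x - 1| ^ (1 - α)) (𝓝[≠] 1) (𝓝 0) := by
    have := h1.abs.rpow_const (p := 1 - α) (Or.inr hα'.le)
    simpa [Real.zero_rpow hα'.ne'] using this
  have hcpow : Tendsto (fun x : ℝ => ((x - 1 : ℝ) : ℂ) ^ ((1 - α : ℝ) : ℂ)) (𝓝[≠] 1) (𝓝 0) := by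
    rw [tendsto_zero_iff_norm_tendsto_zero]
    refine hpow.congr fun x => ?_
    rw [Complex.norm_cpow_real, Complex.norm_real, Real.norm_eq_abs]
  have h2 := (hF.trans_tendsto hpow).add (hcpow.const_mul
    ((r : ℂ) * Complex.exp (Complex.I * (α * ρ * Real.pi : ℝ))))
  simp only [sub_add_cancel, mul_zero, add_zero] at h2
  exact tendsto_nhds_unique (hc.tendsto.mono_left nhdsWithin_le_nhds) h2

section

variable {μ : Measure ℝ} [IsProbabilityMeasure μ]

/-- Stieltjes inversion for the multiplicative Boolean power: its reciprocal Cauchy transform has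
the boundary values `x - (x - F_μ(x + i0)) ^ t`. -/
theorem multBooleanPower_restrict (hμ : μ (Iio 0) = 0)
    (h1 : Tendsto (fun y : ℝ => fTransform μ ((1 : ℝ) + y * Complex.I)) (𝓝[>] 0) (𝓝 0))
    {t : ℝ} (ht : t ∈ Ioc (0 : ℝ) 1) {FB : ℝ → ℂ} {A : Set ℝ} (hA : MeasurableSet A)
    (hlim : ∀ x ∈ A, Tendsto (fun y : ℝ => fTransform μ ((x : ℂ) + y * Complex.I)) (𝓝[>] 0)
      (𝓝 (FB x)))
    (hslit : ∀ x ∈ A, (x : ℂ) - FB x ∈ Complex.slitPlane)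
    (hne : ∀ x ∈ A, powerBoundary FB t x ≠ 0) :
    (multBooleanPower μ t).restrict A = (volume.restrict A).withDensity
      (fun x => ENNReal.ofReal (-((powerBoundary FB t x)⁻¹).im / Real.pi)) := by
  have hν := isMultBooleanPower_multBooleanPower hμ h1 ht
  have := hν.1
  refine restrict_eq_withDensity_of_tendsto_cauchyTransform _ hA fun x hx => ?_
  have hK : Tendsto (fun y : ℝ => selfEnergy μ ((x : ℂ) + y * Complex.I)) (𝓝[>] 0)
      (𝓝 ((x : ℂ) - FB x)) := (tendsto_vertical x).sub (hlim x hx)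
  have hpow := (continuousAt_cpow_const (b := (t : ℂ)) (hslit x hx)).tendsto.comp hK
  refine (((tendsto_vertical x).sub hpow).inv₀ (hne x hx)).congr' ?_
  filter_upwards [self_mem_nhdsWithin] with y hy
  have := fTransform_of_isMultBooleanPower hμ h1 ht hν (z := x + y * Complex.I) (by simpa using hy)
  rw [Function.comp_apply, ← this, fTransform, inv_inv]

/-- A version of the density of `(μ^⟨t⟩)^{t^{-1/α}}`, written with `q = t^{1/α}`; the maximum
with `0` makes it non-negative where it is not the density. -/
noncomputable def powerLawDensity (FB : ℝ → ℂ) (α t y : ℝ) : ℝ :=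
  max 0 (|t ^ (1 / α) * y ^ (t ^ (1 / α) - 1)| *
    (-((powerBoundary FB t (y ^ (t ^ (1 / α))))⁻¹).im / Real.pi))

theorem measurable_powerLawDensity {FB : ℝ → ℂ} (hFB : Measurable FB) (α t : ℝ) :
    Measurable (powerLawDensity FB α t) := by
  unfold powerLawDensity powerBoundary
  fun_prop

end

section

variable {FB : ℝ → ℂ} {α ρ r : ℝ}

theorem tendsto_rpow_one_div_nhdsGT (hα : 0 < α) :
    Tendsto (fun t : ℝ => t ^ (1 / α)) (𝓝[>] 0) (𝓝[>] 0) := by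
  have h : 0 < 1 / α := one_div_pos.2 hα
  refine tendsto_nhdsWithin_iff.2 ⟨?_, ?_⟩
  · have := (Real.continuousAt_rpow_const 0 (1 / α) (Or.inr h.le)).tendsto
    rw [Real.zero_rpow h.ne'] at this
    exact this.mono_left nhdsWithin_le_nhds
  · filter_upwards [self_mem_nhdsWithin] with t ht
    exact Real.rpow_pos_of_pos ht _

/-- Joint convergence, as `(t, y) → (0+, y₀)`, of the densities and of the quantities that have to
stay away from the singularities of the formula for them. -/
theorem tendsto_powerLawDensity (hα : α ∈ Ioo (0 : ℝ) 1) (hρ : ρ ∈ Icc (0 : ℝ) 1) (hr : 0 < r)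
    (hF : (fun x : ℝ => FB x -
        (r : ℂ) * Complex.exp (Complex.I * (α * ρ * Real.pi : ℝ)) *
          ((x - 1 : ℝ) : ℂ) ^ ((1 - α : ℝ) : ℂ))
      =o[𝓝[≠] (1 : ℝ)] (fun x : ℝ => |x - 1| ^ (1 - α)))
    {y₀ : ℝ} (hy₀ : y₀ ∈ Ioi (0 : ℝ) \ {1}) :
    Tendsto (fun i : ℝ × ℝ => powerLawDensity FB α i.1 i.2) (𝓝[>] 0 ×ˢ 𝓝 y₀)
      (𝓝 (logStableDensity α ρ r y₀)) ∧
    Tendsto (fun i : ℝ × ℝ => i.2 ^ (i.1 ^ (1 / α))) (𝓝[>] 0 ×ˢ 𝓝 y₀) (𝓝 1) ∧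
    Tendsto (fun i : ℝ × ℝ => ((i.2 ^ (i.1 ^ (1 / α)) : ℝ) : ℂ) - FB (i.2 ^ (i.1 ^ (1 / α))))
      (𝓝[>] 0 ×ˢ 𝓝 y₀) (𝓝 1) ∧
    ∀ᶠ i : ℝ × ℝ in 𝓝[>] 0 ×ˢ 𝓝 y₀,
      powerBoundary FB i.1 (i.2 ^ (i.1 ^ (1 / α))) ≠ 0 := by
  have hy0 : (0 : ℝ) < y₀ := hy₀.1
  have hl : Real.log y₀ ≠ 0 := fun h => hy₀.2 (Real.eq_one_of_pos_of_log_eq_zero hy0 h)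
  have hq : Tendsto (fun i : ℝ × ℝ => i.1 ^ (1 / α)) (𝓝[>] 0 ×ˢ 𝓝 y₀) (𝓝[>] 0) :=
    (tendsto_rpow_one_div_nhdsGT hα.1).comp tendsto_fst
  have hy : Tendsto (fun i : ℝ × ℝ => i.2) (𝓝[>] (0 : ℝ) ×ˢ 𝓝 y₀) (𝓝 y₀) := tendsto_snd
  have hu : Tendsto (fun i : ℝ × ℝ => Real.log i.2) (𝓝[>] (0 : ℝ) ×ˢ 𝓝 y₀)
      (𝓝 (Real.log y₀)) := hy.log hy0.ne'
  have hypos : ∀ᶠ i : ℝ × ℝ in 𝓝[>] (0 : ℝ) ×ˢ 𝓝 y₀, 0 < i.2 := hy.eventually_const_lt hy0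
  have htpos : ∀ᶠ i : ℝ × ℝ in 𝓝[>] (0 : ℝ) ×ˢ 𝓝 y₀, 0 < i.1 :=
    tendsto_fst.eventually self_mem_nhdsWithin
  have hexp : ∀ i : ℝ × ℝ, 0 < i.2 →
      Real.exp (i.1 ^ (1 / α) * Real.log i.2) = i.2 ^ (i.1 ^ (1 / α)) := fun i hi => by
    rw [Real.rpow_def_of_pos hi, mul_comm]
  have hqt : ∀ i : ℝ × ℝ, 0 < i.1 → (i.1 ^ (1 / α)) ^ α = i.1 := fun i hi => by
    rw [← Real.rpow_mul hi.le, one_div_mul_cancel hα.1.ne', Real.rpow_one]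
  have hx1 : Tendsto (fun i : ℝ × ℝ => i.2 ^ (i.1 ^ (1 / α))) (𝓝[>] 0 ×ˢ 𝓝 y₀) (𝓝 1) := by
    refine ((tendsto_exp_mul_nhdsNE hq hu hl).mono_right nhdsWithin_le_nhds).congr' ?_
    filter_upwards [hypos] with i hi using hexp i hi
  have hK : Tendsto (fun i : ℝ × ℝ =>
      ((i.2 ^ (i.1 ^ (1 / α)) : ℝ) : ℂ) - FB (i.2 ^ (i.1 ^ (1 / α))))
      (𝓝[>] 0 ×ˢ 𝓝 y₀) (𝓝 1) := by
    have := (tendsto_selfEnergy_boundary hα hF hq hu hl).2.add_const 1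
    rw [zero_add] at this
    refine this.congr' ?_
    filter_upwards [hypos] with i hi
    rw [hexp i hi, sub_add_cancel]
  have hΦ : Tendsto (fun i : ℝ × ℝ => powerBoundary FB i.1 (i.2 ^ (i.1 ^ (1 / α))) /
      ((i.1 ^ (1 / α) : ℝ) : ℂ)) (𝓝[>] 0 ×ˢ 𝓝 y₀) (𝓝 (stableF α ρ r (Real.log y₀))) := by
    refine (tendsto_powerBoundary_div hα hF hq hu hl).congr' ?_
    filter_upwards [hypos, htpos] with i hi hi'
    rw [hexp i hi, hqt i hi']
  have hS := stableF_ofReal_ne_zero hα hρ hr hl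
  refine ⟨?_, hx1, hK, ?_⟩
  · have hmain : Tendsto (fun i : ℝ × ℝ => (i.2 ^ (i.1 ^ (1 / α)) * (Real.pi * i.2)⁻¹) *
        -((powerBoundary FB i.1 (i.2 ^ (i.1 ^ (1 / α))) / ((i.1 ^ (1 / α) : ℝ) : ℂ))⁻¹).im)
        (𝓝[>] 0 ×ˢ 𝓝 y₀) (𝓝 ((1 * (Real.pi * y₀)⁻¹) *
          -((stableF α ρ r (Real.log y₀))⁻¹).im)) := by
      refine (hx1.mul ((hy.const_mul _).inv₀ (mul_ne_zero Real.pi_ne_zero hy0.ne'))).mul ?_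
      exact ((Complex.continuous_im.tendsto _).comp (hΦ.inv₀ hS)).neg
    rw [one_mul] at hmain
    have hmax := (tendsto_const_nhds (x := (0 : ℝ))).max hmain
    change Tendsto _ _ (𝓝 (max 0 (logStableDensity α ρ r y₀))) at hmax
    rw [max_eq_right (logStableDensity_nonneg hα hρ hr hy0)] at hmax
    refine hmax.congr' ?_
    filter_upwards [hypos, htpos] with i hi hi'
    rw [powerLawDensity]
    congr 1
    have hqpos : 0 < i.1 ^ (1 / α) := Real.rpow_pos_of_pos hi' _
    rw [abs_of_pos (mul_pos hqpos (Real.rpow_pos_of_pos hi _)), Real.rpow_sub hi, Real.rpow_one,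
      inv_div, div_eq_mul_inv (((i.1 ^ (1 / α) : ℝ) : ℂ)), Complex.im_ofReal_mul]
    field_simp
  · filter_upwards [hΦ.eventually_ne hS] with i hi h
    rw [h, zero_div] at hi
    exact hi rfl

end

/-! ### Convergence of the densities -/

section

variable {μ : Measure ℝ} [IsProbabilityMeasure μ] {α ρ r : ℝ}

theorem isProbabilityMeasure_powerLaw {ν : Measure ℝ} [IsProbabilityMeasure ν] (p : ℝ) :
    IsProbabilityMeasure (powerLaw ν p) :=
  Measure.isProbabilityMeasure_map (by fun_prop)

/-- A property of `(t, y)` that holds near `(0+, y)` for all `y` in a compact set holds for small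
`t` uniformly in `y`. -/
theorem eventually_forall_of_isCompact {K : Set ℝ} (hK : IsCompact K) {P : ℝ × ℝ → Prop}
    (h : ∀ y ∈ K, ∀ᶠ i in 𝓝[>] (0 : ℝ) ×ˢ 𝓝 y, P i) :
    ∀ᶠ t in 𝓝[>] (0 : ℝ), ∀ y ∈ K, P (t, y) := by
  have key : ∀ᶠ t in 𝓝 (0 : ℝ), ∀ y ∈ K, t ∈ Ioi (0 : ℝ) → P (t, y) := by
    refine hK.eventually_forall_of_forall_eventually (P := fun t y => t ∈ Ioi (0 : ℝ) → P (t, y))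
      fun y hy => ?_
    obtain ⟨A, hA, B, hB, hAB⟩ := mem_prod_iff.1 (h y hy)
    filter_upwards [prod_mem_nhds (mem_nhdsWithin_iff_eventually.1 hA) hB] with i hi hi0
    exact hAB ⟨hi.1 hi0, hi.2⟩
  filter_upwards [mem_nhdsWithin_of_mem_nhds key, self_mem_nhdsWithin] with t ht ht' y hy
  exact ht y hy ht'

theorem densitiesTendsto_powerLaw (hμ : μ (Iio 0) = 0) (hbv : BoundaryValueAssumption μ)
    (hα : α ∈ Ioo (0 : ℝ) 1) (hρ : ρ ∈ Icc (0 : ℝ) 1) (hr : 0 < r)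
    (hF : (fun x : ℝ => fBoundary μ x -
        (r : ℂ) * Complex.exp (Complex.I * (α * ρ * Real.pi : ℝ)) *
          ((x - 1 : ℝ) : ℂ) ^ ((1 - α : ℝ) : ℂ))
      =o[𝓝[≠] (1 : ℝ)] (fun x : ℝ => |x - 1| ^ (1 - α)))
    (h1 : Tendsto (fun y : ℝ => fTransform μ ((1 : ℝ) + y * Complex.I)) (𝓝[>] 0) (𝓝 0)) :
    DensitiesTendstoUniformlyOnCompacts
      (fun t => powerLaw (multBooleanPower μ t) (t ^ (-(1 / α)))) (logStableDensity α ρ r)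
      (Ioi 0 \ {1}) := by
  obtain ⟨I, hI, h1I, hlim⟩ := hbv.exists_tendsto
  set FB : ℝ → ℂ := I.indicator (fBoundary μ) with hFBdef
  have hFB : ∀ x ∈ I, FB x = fBoundary μ x := fun x hx => indicator_of_mem hx _
  have hF' : (fun x : ℝ => FB x -
        (r : ℂ) * Complex.exp (Complex.I * (α * ρ * Real.pi : ℝ)) *
          ((x - 1 : ℝ) : ℂ) ^ ((1 - α : ℝ) : ℂ))
      =o[𝓝[≠] (1 : ℝ)] (fun x : ℝ => |x - 1| ^ (1 - α)) := by
    refine hF.congr' ?_ EventuallyEq.rfl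
    filter_upwards [mem_nhdsWithin_of_mem_nhds (hI.mem_nhds h1I)] with x hx
    rw [hFB x hx]
  refine ⟨powerLawDensity FB α,
    measurable_powerLawDensity (measurable_indicator_fBoundary hI hlim) α,
    fun t x => le_max_left _ _, fun K hK hKU => ⟨?_, ?_⟩⟩
  · have hev : ∀ᶠ t in 𝓝[>] (0 : ℝ), ∀ y ∈ K, (y ^ (t ^ (1 / α)) ∈ I ∧
        ((y ^ (t ^ (1 / α)) : ℝ) : ℂ) - FB (y ^ (t ^ (1 / α))) ∈ Complex.slitPlane) ∧
        powerBoundary FB t (y ^ (t ^ (1 / α))) ≠ 0 := by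
      refine eventually_forall_of_isCompact hK (P := fun i => (i.2 ^ (i.1 ^ (1 / α)) ∈ I ∧
        ((i.2 ^ (i.1 ^ (1 / α)) : ℝ) : ℂ) - FB (i.2 ^ (i.1 ^ (1 / α))) ∈ Complex.slitPlane) ∧
        powerBoundary FB i.1 (i.2 ^ (i.1 ^ (1 / α))) ≠ 0) fun y hy => ?_
      obtain ⟨-, hx, hs, hne⟩ := tendsto_powerLawDensity hα hρ hr hF' (hKU hy)
      exact ((hx.eventually (hI.mem_nhds h1I)).and (hs.eventually
        (Complex.isOpen_slitPlane.mem_nhds Complex.one_mem_slitPlane))).and hne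
    filter_upwards [hev, Ioc_mem_nhdsGT (zero_lt_one' ℝ)] with t ht ht01
    have hν := isMultBooleanPower_multBooleanPower hμ h1 ht01
    have hq : 0 < t ^ (1 / α) := Real.rpow_pos_of_pos ht01.1 _
    have hpq : t ^ (-(1 / α)) = (t ^ (1 / α))⁻¹ := Real.rpow_neg ht01.1.le _
    have hpos : ∀ y ∈ K, 0 < y := fun y hy => (hKU hy).1
    have himg : MeasurableSet ((fun y : ℝ => y ^ (t ^ (1 / α))) '' K) :=
      (hK.image_of_continuousOn fun y hy =>
        (Real.continuousAt_rpow_const y _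
          (Or.inl (hpos y hy).ne')).continuousWithinAt).measurableSet
    have hres := multBooleanPower_restrict hμ h1 ht01 (FB := FB) himg
      (by rintro _ ⟨y, hy, rfl⟩; rw [hFB _ (ht y hy).1.1]; exact hlim _ (ht y hy).1.1)
      (by rintro _ ⟨y, hy, rfl⟩; exact (ht y hy).1.2)
      (by rintro _ ⟨y, hy, rfl⟩; exact (ht y hy).2)
    have hae : ∀ᵐ x ∂(multBooleanPower μ t), 0 ≤ x := by
      rw [ae_iff]
      simp only [not_le]
      exact hν.2.1
    have hmap := map_restrict_eq_withDensity (φ := fun x : ℝ => x ^ (t ^ (-(1 / α))))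
      (ψ' := fun y => t ^ (1 / α) * y ^ (t ^ (1 / α) - 1))
      (by fun_prop) hK.measurableSet
      (fun y hy => Real.hasDerivAt_rpow_const (Or.inl (hpos y hy).ne'))
      (fun y hy => by
        rw [hpq, Real.rpow_rpow_inv (hpos y hy).le hq.ne'])
      (by
        filter_upwards [hae] with x hx _
        rw [hpq, Real.rpow_inv_rpow hx hq.ne'])
      hres
    rw [powerLaw, hmap]
    refine withDensity_congr_ae (Eventually.of_forall fun y => ?_)
    simp only [powerLawDensity, ENNReal.ofReal_max, ENNReal.ofReal_zero, max_eq_right,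
      zero_le]
  · rw [← tendstoLocallyUniformlyOn_iff_tendstoUniformlyOn_of_compact hK,
      tendstoLocallyUniformlyOn_iff_forall_tendsto]
    intro y hy
    have hle : 𝓝[>] (0 : ℝ) ×ˢ 𝓝[K] y ≤ 𝓝[>] (0 : ℝ) ×ˢ 𝓝 y :=
      prod_mono le_rfl nhdsWithin_le_nhds
    have ht := (tendsto_powerLawDensity hα hρ hr hF' (hKU hy)).1.mono_left hle
    have hp : Tendsto (fun i : ℝ × ℝ => logStableDensity α ρ r i.2) (𝓝[>] (0 : ℝ) ×ˢ 𝓝[K] y)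
        (𝓝 (logStableDensity α ρ r y)) :=
      (((continuousOn_logStableDensity hα hρ hr).mono hKU) y hy).tendsto.comp tendsto_snd
    exact (hp.prodMk_nhds ht).mono_right (nhds_le_uniformity _)

end

/-- Convergence of densities passes to a smaller set and to an equal limit function there. -/
theorem DensitiesTendstoUniformlyOnCompacts.mono_congr {ν : ℝ → Measure ℝ} {p p' : ℝ → ℝ}
    {U V : Set ℝ} (h : DensitiesTendstoUniformlyOnCompacts ν p U) (hVU : V ⊆ U)
    (hp : EqOn p p' V) : DensitiesTendstoUniformlyOnCompacts ν p' V := by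
  obtain ⟨f, hfm, hf0, hf⟩ := h
  refine ⟨f, hfm, hf0, fun K hK hKV => ?_⟩
  obtain ⟨h1, h2⟩ := hf K hK (hKV.trans hVU)
  exact ⟨h1, h2.congr_right (hp.mono hKV)⟩

end LogBoolean

theorem mainTheorem9 (μ : Measure ℝ) [IsProbabilityMeasure μ] (hμ : μ (Iio 0) = 0)
    (hbv : LogBoolean.BoundaryValueAssumption μ)
    (α ρ r : ℝ) (hα : α ∈ Ioo (0 : ℝ) 1) (hρ : ρ ∈ Icc (0 : ℝ) 1) (hr : 0 < r)
    -- for `x < 1` the principal power of the negative real `x - 1` is the `+ i0` boundary value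
    (hF : (fun x : ℝ => LogBoolean.fBoundary μ x -
        (r : ℂ) * Complex.exp (Complex.I * (α * ρ * Real.pi : ℝ)) *
          ((x - 1 : ℝ) : ℂ) ^ ((1 - α : ℝ) : ℂ))
      =o[𝓝[≠] (1 : ℝ)] (fun x : ℝ => |x - 1| ^ (1 - α))) :
    -- the convolution powers and the limit law exist
    (∀ t ∈ Ioc (0 : ℝ) 1,
      LogBoolean.IsMultBooleanPower μ t (LogBoolean.multBooleanPower μ t)) ∧
    LogBoolean.IsBooleanStableLaw α ρ r (LogBoolean.booleanStableLaw α ρ r) ∧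
    -- convergence of the densities on `(1, ∞)`
    LogBoolean.DensitiesTendstoUniformlyOnCompacts
      (fun t => LogBoolean.powerLaw (LogBoolean.multBooleanPower μ t) (t ^ (-(1 / α))))
      (fun x => r * Real.sin (α * ρ * Real.pi) / (Real.pi * x) *
        ((Real.log x) ^ (α - 1) /
          ((Real.log x) ^ (2 * α) +
            2 * r * Real.cos (α * ρ * Real.pi) * (Real.log x) ^ α + r ^ 2)))
      (Ioi 1) ∧
    -- convergence of the densities on `(0, 1)`
    LogBoolean.DensitiesTendstoUniformlyOnCompacts
      (fun t => LogBoolean.powerLaw (LogBoolean.multBooleanPower μ t) (t ^ (-(1 / α))))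
      (fun x => r * Real.sin (α * (1 - ρ) * Real.pi) / (Real.pi * x) *
        ((-Real.log x) ^ (α - 1) /
          ((-Real.log x) ^ (2 * α) +
            2 * r * Real.cos (α * (1 - ρ) * Real.pi) * (-Real.log x) ^ α + r ^ 2)))
      (Ioo 0 1) ∧
    -- weak convergence to the law of `e^B`
    (∀ g : BoundedContinuousFunction ℝ ℝ,
      Tendsto
        (fun t : ℝ => ∫ x, g x
          ∂(LogBoolean.powerLaw (LogBoolean.multBooleanPower μ t) (t ^ (-(1 / α)))))
        (𝓝[>] 0) (𝓝 (∫ x, g x ∂(LogBoolean.logBooleanStableLaw α ρ r)))) := by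
  have h1 : Tendsto (fun y : ℝ => LogBoolean.fTransform μ ((1 : ℝ) + y * Complex.I)) (𝓝[>] 0)
      (𝓝 0) := by
    obtain ⟨I, -, h1I, hlim⟩ := hbv.exists_tendsto
    rw [← LogBoolean.fBoundary_one_eq_zero hbv.2 hα.2 hF]
    exact hlim 1 h1I
  have hd := LogBoolean.densitiesTendsto_powerLaw hμ hbv hα hρ hr hF h1
  refine ⟨fun t ht => LogBoolean.isMultBooleanPower_multBooleanPower hμ h1 ht,
    LogBoolean.isBooleanStableLaw_booleanStableLaw hα hρ hr,
    hd.mono_congr (fun x hx => ⟨mem_Ioi.2 (zero_lt_one.trans (mem_Ioi.1 hx)), ne_of_gt hx⟩)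
      fun x hx => LogBoolean.logStableDensity_of_one_lt α ρ r hx,
    hd.mono_congr (fun x hx => ⟨hx.1, ne_of_lt hx.2⟩)
      fun x hx => LogBoolean.logStableDensity_of_lt_one α ρ r hx, ?_⟩
  have := LogBoolean.isProbabilityMeasure_logBooleanStableLaw hα hρ hr
  refine LogBoolean.tendsto_integral_of_densities (isOpen_Ioi.sdiff isClosed_singleton)
    (LogBoolean.logBooleanStableLaw_compl hα hρ hr) ?_ hd
    (LogBoolean.continuousOn_logStableDensity hα hρ hr)
    fun K hK hKU => LogBoolean.logBooleanStableLaw_restrict hα hρ hr hK.measurableSet hKU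
  filter_upwards [Ioc_mem_nhdsGT (zero_lt_one' ℝ)] with t ht
  have := (LogBoolean.isMultBooleanPower_multBooleanPower hμ h1 ht).1
  exact LogBoolean.isProbabilityMeasure_powerLaw _
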